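/- Let $k\ge 2$, let $\Gamma^k=(V,L)$ be the Cayley tree of order $k$ (the infinite tree in which every vertex has exactly $k+1$ neighbours), with a fixed root $x^0\in V$, and let $V_n$, $W_n$ be the ball and the sphere of radius $n$ about $x^0$. Write each edge as $\langle x,y\rangle$ with $y$ the direct successor of $x$ (the endpoint farther from $x^0$). Let $K:[0,1]^2\to(0,\infty)$ be continuous, and consider configurations $\sigma\in\Omega=[0,1]^V$ (with the product $\sigma$-algebra) and the Hamiltonian $$H(\sigma)=-\sum_{\langle x,y\rangle\in L}\ln K(\sigma(x),\sigma(y)),$$ the inverse temperature being absorbed in $K$; $H(\sigma_n)$ denotes the sum restricted to the edges inside $V_n$. A probability measure $\mu$ on $\Omega$ is a *Gibbs measure* if for every $n\ge1$ the law of $\sigma|_{V_n}$ under $\mu$ has, with respect to Lebesgue measure on $[0,1]^{V_n}$, the density $$\sigma_n\mapsto\int_\Omega \frac{1}{Z_n(\omega)}\exp\Big(-H(\sigma_n)+\sum_{x\in V_n,\,y\in W_{n+1},\,\langle x,y\rangle\in L}\ln K(\sigma_n(x),\omega(y))\Big)\,\mu(d\omega),$$ where $Z_n(\omega)$ is the normalizing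 constant. It is a *splitting Gibbs measure* if there are bounded measurable functions $t\mapsto h_{t,x}$ on $[0,1]$, $x\in V\setminus\{x^0\}$, such that for every $n\ge 1$ the law of $\sigma|_{V_n}$ has the density $Z_n^{-1}\exp\big(-H(\sigma_n)+\sum_{x\in W_n}h_{\sigma_n(x),x}\big)$, with $Z_n$ the normalizing constant; it has a *translation-invariant boundary function* if these $h$ can be chosen such that $\exp(h_{t,x}-h_{0,x})$ does not depend on $x\neq x^0$. Given a group of automorphisms of the tree acting transitively on $V$ (for example the left translations of $\Gamma^k$ viewed as the Cayley graph of the free product of $k+1$ groups of order two, or all automorphisms), $\mu$ is *translation-invariant* if it is invariant under the shifts $\sigma\mapsto\sigma\circ g$ for all $g$ in the group. Let $M=\max K$, $m=\min K$, and suppose $$\Big(\frac Mm\Big)^k-\Big(\frac mM\Big)^k<\frac1k .$$ Then there is a probability measure $\mu$ on $\Omega$ such that: 1. $\mu$ is a Gibbs measure, and $\mu$ is the unique splitting Gibbs measure with translation-invariant boundary function; 2. for every vertex-transitive group of automorphisms of the tree, every translation-invariant Gibbs measure and every translation-invariant splitting Gibbs measure is equal to $\mu$; and if $K$ is symmetric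 (so that $H$ does not depend on the orientation of the edges), then $\mu$ is translation-invariant. In particular, for symmetric $K$ the model has exactly one translation-invariant Gibbs measure and exactly one translation-invariant splitting Gibbs measure, and they coincide. -/

import Mathlib

open MeasureTheory

noncomputable section

namespace CayleyGibbs

/-- A configuration on the whole vertex set, with spins in `[0,1]`. -/
abbrev Config (V : Type*) : Type _ := V → unitInterval

section Geometry

variable {V : Type*} (G : SimpleGraph V)

/-- The ball `V_n` of radius `n` about `x₀`. The extended graph distance is the length of a
shortest path (and is finite on a connected graph). -/
def ball (x₀ : V) (n : ℕ) : Set V := {x | G.edist x₀ x ≤ n}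

/-- The sphere `W_n` of radius `n` about `x₀`. -/
def sphere (x₀ : V) (n : ℕ) : Set V := {x | G.edist x₀ x = n}

/-- `y` is a direct successor of `x` with respect to the root `x₀`. Every edge `⟨x,y⟩` of a tree
is written in exactly one way with `y` a direct successor of `x`. -/
def IsSucc (x₀ x y : V) : Prop := G.Adj x y ∧ G.edist x₀ y = G.edist x₀ x + 1

theorem ball_finite [G.LocallyFinite] (x₀ : V) (n : ℕ) : (ball G x₀ n).Finite := by
  induction n with
  | zero =>
    refine (Set.finite_singleton x₀).subset fun x hx => ?_
    have h : G.edist x₀ x ≤ 0 := by exact_mod_cast hx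
    exact (SimpleGraph.edist_eq_zero_iff.1 (nonpos_iff_eq_zero.1 h)).symm
  | succ n ih =>
    refine (ih.union (ih.biUnion fun x _ => (G.neighborSet x).toFinite)).subset fun y hy => ?_
    have hy' : G.edist x₀ y ≤ ((n + 1 : ℕ) : ℕ∞) := hy
    obtain ⟨w, hw⟩ := SimpleGraph.exists_walk_of_edist_ne_top
      (ne_top_of_le_ne_top (ENat.natCast_ne_top (n + 1)) hy')
    have hwl : w.length ≤ n + 1 := by
      rw [← hw] at hy'; exact_mod_cast hy'
    by_cases hnil : w.Nil
    · left
      have : x₀ = y := hnil.eq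
      subst this
      simp [ball]
    · right
      refine Set.mem_biUnion (x := w.penultimate) ?_ (w.adj_penultimate hnil)
      have h1 : G.edist x₀ w.penultimate ≤ (w.dropLast.length : ℕ∞) :=
        SimpleGraph.edist_le w.dropLast
      have h2 : w.dropLast.length ≤ n := by
        have := w.length_dropLast_add_one hnil
        omega
      exact h1.trans (by exact_mod_cast h2)

instance [G.LocallyFinite] (x₀ : V) (n : ℕ) : Fintype (ball G x₀ n) :=
  (ball_finite G x₀ n).fintype

instance [G.LocallyFinite] (x₀ : V) (n : ℕ) : Fintype (sphere G x₀ n) :=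
  ((ball_finite G x₀ n).subset fun _ hx => le_of_eq hx).fintype

end Geometry

section Model

variable {V : Type*} (G : SimpleGraph V) [G.LocallyFinite] (K : unitInterval → unitInterval → ℝ) (x₀ : V)

open Classical in
/-- `H(σ_n) = -∑ ln K(σ_n(x), σ_n(y))`, the sum over the edges `⟨x,y⟩` inside `V_n`
(`y` being the direct successor of `x`). -/
def energy (n : ℕ) (σ : ball G x₀ n → unitInterval) : ℝ :=
  -∑ x : ball G x₀ n, ∑ y : ball G x₀ n,
    if IsSucc G x₀ x y then Real.log (K (σ x) (σ y)) else 0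

open Classical in
/-- `U(σ_n, ω|_{W_{n+1}}) = -∑ ln K(σ_n(x), ω(y))`, the sum over the edges `⟨x,y⟩` with
`x ∈ V_n` and `y ∈ W_{n+1}`. -/
def boundaryEnergy (n : ℕ) (σ : ball G x₀ n → unitInterval) (ω : Config V) : ℝ :=
  -∑ x : ball G x₀ n, ∑ y : sphere G x₀ (n + 1),
    if IsSucc G x₀ x y then Real.log (K (σ x) (ω y)) else 0

/-- The conditional Gibbs density `ν^{V_n}_{ω|_{W_{n+1}}}` with respect to the product Lebesgue
measure on `[0,1]^{V_n}`. -/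
def gibbsDensity (n : ℕ) (ω : Config V) (σ : ball G x₀ n → unitInterval) : ℝ :=
  Real.exp (-(energy G K x₀ n σ + boundaryEnergy G K x₀ n σ ω)) /
    ∫ τ : ball G x₀ n → unitInterval, Real.exp (-(energy G K x₀ n τ + boundaryEnergy G K x₀ n τ ω))

/-- `μ` satisfies the DLR equation: for every `n ≥ 1` the restriction of the random configuration
to `V_n` has, with respect to the product Lebesgue measure on `[0,1]^{V_n}`, the density
`σ_n ↦ ∫ ν^{V_n}_{ω|_{W_{n+1}}}(σ_n) μ(dω)`. -/
def IsGibbs (μ : Measure (Config V)) : Prop :=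
  ∀ n : ℕ, 1 ≤ n →
    μ.map (Set.domRestrict (ball G x₀ n)) =
      (volume : Measure (ball G x₀ n → unitInterval)).withDensity
        (fun σ => ∫⁻ ω, ENNReal.ofReal (gibbsDensity G K x₀ n ω σ) ∂μ)

open Classical in
/-- The unnormalized density `exp(-H(σ_n) + ∑_{x ∈ W_n} h_{σ_n(x),x})`. -/
def splittingWeight (h : V → unitInterval → ℝ) (n : ℕ) (σ : ball G x₀ n → unitInterval) : ℝ :=
  Real.exp (-energy G K x₀ n σ +
    ∑ x : ball G x₀ n, if (x : V) ∈ sphere G x₀ n then h x (σ x) else 0)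

/-- The probability distribution `μ^{(n)}` on `[0,1]^{V_n}` determined by `h`. -/
def splittingLaw (h : V → unitInterval → ℝ) (n : ℕ) : Measure (ball G x₀ n → unitInterval) :=
  (volume : Measure (ball G x₀ n → unitInterval)).withDensity (fun σ =>
    ENNReal.ofReal (splittingWeight G K x₀ h n σ / ∫ τ, splittingWeight G K x₀ h n τ))

/-- `μ` is the splitting Gibbs measure corresponding to `K` and to the boundary function
`x ↦ h_x = (h_{t,x})_{t ∈ [0,1]}`, `x ≠ x₀`, each `h_x` being bounded and measurable: its
restrictions to the balls `V_n`, `n ≥ 1`, have the laws `μ^{(n)}`. The value of `h` at `x₀` plays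
no role. -/
def IsSplittingWith (h : V → unitInterval → ℝ) (μ : Measure (Config V)) : Prop :=
  (∀ x, x ≠ x₀ → Measurable (h x) ∧ ∃ C : ℝ, ∀ t, |h x t| < C) ∧
  ∀ n : ℕ, 1 ≤ n → μ.map (Set.domRestrict (ball G x₀ n)) = splittingLaw G K x₀ h n

/-- `μ` is a splitting Gibbs measure. -/
def IsSplitting (μ : Measure (Config V)) : Prop :=
  ∃ h : V → unitInterval → ℝ, IsSplittingWith G K x₀ h μ

/-- `μ` is a splitting Gibbs measure with a translation-invariant boundary function:
`f(t,x) = exp(h_{t,x} - h_{0,x})` does not depend on `x ≠ x₀`. -/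
def IsHomogeneousSplitting (μ : Measure (Config V)) : Prop :=
  ∃ h : V → unitInterval → ℝ, IsSplittingWith G K x₀ h μ ∧
    ∀ x y, x ≠ x₀ → y ≠ x₀ → ∀ t,
      Real.exp (h x t - h x 0) = Real.exp (h y t - h y 0)

end Model

section Invariance

variable {V : Type*} {G : SimpleGraph V}

/-- A group of automorphisms of the tree acts transitively on the vertices. The left translations
of the tree, seen as the Cayley graph of the free product of `k + 1` groups of order two, and the
full automorphism group are examples. -/
def IsVertexTransitive (Γ : Subgroup (G ≃g G)) : Prop :=
  ∀ x y : V, ∃ g ∈ Γ, g x = y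

/-- `μ` is invariant under the shifts `σ ↦ σ ∘ g`, `g ∈ Γ`. -/
def IsInvariant (Γ : Subgroup (G ≃g G)) (μ : Measure (Config V)) : Prop :=
  ∀ g ∈ Γ, μ.map (fun (σ : Config V) (x : V) => σ (g x)) = μ

end Invariance

end CayleyGibbs

end

/-! A stronger statement carries the theorem: under the hypothesis there is only one Gibbs measure,
so every uniqueness claim reduces to showing that the measures in question are Gibbs.

Uniqueness is Dobrushin's argument. Changing one neighbouring spin alters the unnormalized weight of
a spin by a factor at least `m / M`, and so does the normalizer, so the conditional densities keep a
common part of mass `(m / M) ^ 2`. With `k + 1` neighbours the Dobrushin condition reads `(k + 1) *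
(1 - (m / M) ^ 2) < 1`, which the hypothesis implies by Bernoulli's inequality
(`mul_one_sub_sq_lt_one`). The DLR equations on balls give the single-site conditional densities
(`IsGibbs.isSingleSiteGibbs`), and `IsSingleSiteSpec.unique` applies. Splitting measures are covered
because the boundary term on `W_{n+1}` does not involve the spins in `V_n`, so the conditional law
inside is the Gibbs one (`IsSplitting.isGibbs`).

Existence uses a constant boundary function `φ` with `φ t = k * (log (K e^φ)(t) - log (K e^φ)(0))`.
The kernel contracts Hilbert's projective metric by `1 - (m / M) ^ 2`, so iteration converges when
`k * (1 - (m / M) ^ 2) < 1`. The equation for `φ` makes the finite-volume laws consistent, and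
compactness of the probability measures on `[0,1]^V` extends them to the tree.

For symmetric `K` the single-site densities commute with automorphisms, so the image of the Gibbs
measure under a shift has the same conditional densities and coincides with it by uniqueness. -/

set_option linter.unusedSectionVars false

noncomputable section

namespace CayleyGibbs

/-! ### Dobrushin uniqueness for finite-range single-site densities -/

section Dobrushin

open Function

/-- Averages of `g` under two probability densities, one of which dominates `1 - c` times the
other, differ by at most `c` times the oscillation of `g`. -/
theorem abs_integral_mul_sub_le {S : Type*} [MeasurableSpace S] {l : Measure S}
    {q q' g : S → ℝ} {c D : ℝ} (hq0 : ∀ s, 0 ≤ q s) (hq1 : ∫ s, q s ∂l = 1)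
    (hq1' : ∫ s, q' s ∂l = 1) (hqq : ∀ s, (1 - c) * q s ≤ q' s)
    (hg : Measurable g) (hD : ∀ s s', |g s - g s'| ≤ D) :
    |∫ s, q' s * g s ∂l - ∫ s, q s * g s ∂l| ≤ c * D := by
  have hqi : Integrable q l := by
    by_contra h; rw [integral_undef h] at hq1; norm_num at hq1
  have hqi' : Integrable q' l := by
    by_contra h; rw [integral_undef h] at hq1'; norm_num at hq1'
  have hmul : ∀ {a : S → ℝ}, Integrable a l → Integrable (fun s => a s * g s) l := by
    intro a ha
    rcases isEmpty_or_nonempty S with hS | ⟨⟨s₀⟩⟩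
    · have : l = 0 := Measure.eq_zero_of_isEmpty l
      simp [this]
    · refine ha.mul_bdd (c := |g s₀| + D) hg.aestronglyMeasurable (ae_of_all _ fun s => ?_)
      have h1 := hD s s₀
      have h2 := abs_add_le (g s - g s₀) (g s₀)
      rw [Real.norm_eq_abs]
      have h3 : g s - g s₀ + g s₀ = g s := by ring
      rw [h3] at h2; linarith
  -- Splitting off the common part `(1 - c) q` leaves `e ≥ 0` of mass `c`. The difference of
  -- averages is then the double integral of `e s * q s' * (g s - g s')`; the integral in `s` is
  -- bounded first with `s'` frozen, and `s'` is averaged against `q` afterwards.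
  set e : S → ℝ := fun s => q' s - (1 - c) * q s with he
  have hei : Integrable e l := hqi'.sub (hqi.const_mul _)
  have he0 : ∀ s, 0 ≤ e s := fun s => by have := hqq s; simp only [he]; linarith
  have he1 : ∫ s, e s ∂l = c := by
    simp only [he]; rw [integral_sub hqi' (hqi.const_mul _), integral_const_mul, hq1, hq1']; ring
  set A := ∫ s, e s * g s ∂l with hA
  set B := ∫ s, q s * g s ∂l with hB
  have hAB : ∫ s, q' s * g s ∂l - B = A - c * B := by
    have : ∀ s, e s * g s = q' s * g s - (1 - c) * (q s * g s) := fun s => by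
      simp only [he]; ring
    rw [hA]; simp_rw [this]
    rw [integral_sub (hmul hqi') ((hmul hqi).const_mul _), integral_const_mul]; ring
  have hs : ∀ s', |A - c * g s'| ≤ c * D := by
    intro s'
    have h1 : A - c * g s' = ∫ s, e s * (g s - g s') ∂l := by
      simp_rw [mul_sub]
      rw [integral_sub (hmul hei) (hei.mul_const _), integral_mul_const, he1]
    rw [h1, ← he1, ← integral_mul_const]
    refine (abs_integral_le_integral_abs).trans (integral_mono_of_nonneg
      (ae_of_all _ fun s => abs_nonneg _) (hei.mul_const _) (ae_of_all _ fun s => ?_))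
    simp only [abs_mul, abs_of_nonneg (he0 s)]
    exact mul_le_mul_of_nonneg_left (hD s s') (he0 s)
  have h2 : A - c * B = ∫ s, q s * (A - c * g s) ∂l := by
    have : ∀ s, q s * (A - c * g s) = q s * A - c * (q s * g s) := fun s => by ring
    simp_rw [this]
    rw [integral_sub (hqi.mul_const _) ((hmul hqi).const_mul _), integral_mul_const, hq1,
      integral_const_mul]; ring
  rw [hAB, h2]
  calc _ ≤ ∫ s, |q s * (A - c * g s)| ∂l := abs_integral_le_integral_abs
    _ ≤ ∫ s, q s * (c * D) ∂l := by
      refine integral_mono_of_nonneg (ae_of_all _ fun s => abs_nonneg _) (hqi.mul_const _)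
        (ae_of_all _ fun s => ?_)
      simp only [abs_mul, abs_of_nonneg (hq0 s)]
      exact mul_le_mul_of_nonneg_left (hs s) (hq0 s)
    _ = c * D := by rw [integral_mul_const, hq1, one_mul]

variable {V S : Type*} [DecidableEq V] [MeasurableSpace S] {l : Measure S}

/-- Single-site conditional probability densities `p i ω` (with respect to `l`) of the spin at `i`
given the configuration `ω`, which depend only on the spins in the finite neighbourhood `N i` and
vary by a factor at least `1 - c` when one spin is changed. -/
structure IsSingleSiteSpec (l : Measure S) (N : V → Finset V) (c : ℝ)
    (p : V → (V → S) → S → ℝ) : Prop where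
  nonneg : ∀ i ω t, 0 ≤ p i ω t
  meas : ∀ i, Measurable (uncurry (p i))
  integral_eq_one : ∀ i ω, ∫ t, p i ω t ∂l = 1
  dependsOn : ∀ i, DependsOn (p i) (N i)
  notMem : ∀ i, i ∉ N i
  ratio : ∀ i ω j u t, (1 - c) * p i ω t ≤ p i (update ω j u) t

/-- `ν` is consistent with the single-site conditional densities `p`. -/
def IsSingleSiteGibbs (l : Measure S) (p : V → (V → S) → S → ℝ) (ν : Measure (V → S)) : Prop :=
  ∀ i, ∀ f : (V → S) → ENNReal, Measurable f → (∃ Λ : Finset V, DependsOn f (Λ : Set V)) →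
    ∫⁻ ω, f ω ∂ν = ∫⁻ ω, ∫⁻ t, ENNReal.ofReal (p i ω t) * f (update ω i t) ∂l ∂ν

/-- The conditional expectation of `f` given all spins but the one at `i`. -/
def siteAverage (l : Measure S) (p : V → (V → S) → S → ℝ) (i : V) (f : (V → S) → ℝ) (ω : V → S) :
    ℝ :=
  ∫ t, p i ω t * f (update ω i t) ∂l

theorem measurable_update_uncurry (i : V) :
    Measurable (fun x : (V → S) × S => update x.1 i x.2) := by
  refine measurable_pi_lambda _ fun j => ?_
  by_cases h : j = i
  · subst h; simpa using measurable_snd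
  · simp only [update_of_ne h]; exact (measurable_pi_apply j).comp measurable_fst

theorem measurable_siteAverage [SFinite l] {p : V → (V → S) → S → ℝ} {N : V → Finset V} {c : ℝ}
    (hp : IsSingleSiteSpec l N c p) (i : V) {f : (V → S) → ℝ} (hf : Measurable f) :
    Measurable (siteAverage l p i f) := by
  have : Measurable (fun x : (V → S) × S => p i x.1 x.2 * f (update x.1 i x.2)) :=
    (hp.meas i).mul (hf.comp (measurable_update_uncurry i))
  exact this.stronglyMeasurable.integral_prod_right.measurable

theorem IsSingleSiteSpec.integrable {p : V → (V → S) → S → ℝ} {N : V → Finset V} {c : ℝ}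
    (hp : IsSingleSiteSpec l N c p) (i : V) (ω : V → S) : Integrable (p i ω) l := by
  by_contra h
  have := hp.integral_eq_one i ω
  rw [integral_undef h] at this; norm_num at this

/-- Consistency is formulated with `∫⁻` for nonnegative functions. Adding the bound `C` makes `f`
nonnegative, and averaging commutes with adding a constant because the densities have mass one. -/
theorem IsSingleSiteGibbs.integral_siteAverage [SFinite l] {p : V → (V → S) → S → ℝ}
    {N : V → Finset V} {c : ℝ} (hp : IsSingleSiteSpec l N c p) {ν : Measure (V → S)}
    [IsProbabilityMeasure ν] (hν : IsSingleSiteGibbs l p ν) (i : V) {f : (V → S) → ℝ}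
    (hf : Measurable f) {Λ : Finset V} (hΛ : DependsOn f (Λ : Set V)) {C : ℝ}
    (hC : ∀ ω, |f ω| ≤ C) :
    ∫ ω, siteAverage l p i f ω ∂ν = ∫ ω, f ω ∂ν := by
  have hpf : ∀ ω, Integrable (fun t => p i ω t * f (update ω i t)) l := fun ω =>
    (hp.integrable i ω).mul_bdd (c := C)
      ((hf.comp ((measurable_update_uncurry i).comp measurable_prodMk_left)).aestronglyMeasurable)
      (ae_of_all _ fun t => hC _)
  have hshift : ∀ ω, siteAverage l p i (fun ω => f ω + C) ω = siteAverage l p i f ω + C := by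
    intro ω
    simp only [siteAverage, mul_add]
    rw [integral_add (hpf ω) ((hp.integrable i ω).mul_const _), integral_mul_const,
      hp.integral_eq_one, one_mul]
  have hb : ∀ ω, |siteAverage l p i f ω| ≤ C := by
    intro ω
    calc _ ≤ ∫ t, |p i ω t * f (update ω i t)| ∂l := abs_integral_le_integral_abs
      _ ≤ ∫ t, p i ω t * C ∂l := by
        refine integral_mono_of_nonneg (ae_of_all _ fun s => abs_nonneg _)
          ((hp.integrable i ω).mul_const _) (ae_of_all _ fun s => ?_)
        simp only [abs_mul, abs_of_nonneg (hp.nonneg i ω s)]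
        exact mul_le_mul_of_nonneg_left (hC _) (hp.nonneg i ω s)
      _ = C := by rw [integral_mul_const, hp.integral_eq_one, one_mul]
  have hgm : Measurable (fun ω => f ω + C) := hf.add_const C
  have hg0 : ∀ ω, 0 ≤ f ω + C := fun ω => by have := abs_le.1 (hC ω); linarith
  have key : ∫ ω, siteAverage l p i (fun ω => f ω + C) ω ∂ν = ∫ ω, (f ω + C) ∂ν := by
    rw [integral_eq_lintegral_of_nonneg_ae (ae_of_all _ hg0) hgm.aestronglyMeasurable,
      integral_eq_lintegral_of_nonneg_ae (f := siteAverage l p i fun ω => f ω + C)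
        (ae_of_all _ fun ω => integral_nonneg fun t => mul_nonneg (hp.nonneg i ω t) (hg0 _))
        (measurable_siteAverage hp i hgm).aestronglyMeasurable,
      hν i (fun ω => ENNReal.ofReal (f ω + C)) hgm.ennreal_ofReal
        ⟨Λ, fun x y hxy => by simp only [hΛ hxy]⟩]
    congr 1
    refine lintegral_congr fun ω => ?_
    rw [siteAverage, ofReal_integral_eq_lintegral_ofReal]
    · exact lintegral_congr fun t => ENNReal.ofReal_mul (hp.nonneg i ω t)
    · simp_rw [mul_add]; exact (hpf ω).add ((hp.integrable i ω).mul_const _)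
    · exact ae_of_all _ fun t => mul_nonneg (hp.nonneg i ω t) (hg0 _)
  simp_rw [hshift] at key
  have i1 : Integrable f ν := Integrable.of_bound hf.aestronglyMeasurable C (ae_of_all _ hC)
  have i2 : Integrable (siteAverage l p i f) ν :=
    Integrable.of_bound (measurable_siteAverage hp i hf).aestronglyMeasurable C (ae_of_all _ hb)
  rw [integral_add i2 (integrable_const _), integral_add i1 (integrable_const _)] at key
  linarith

/-- The oscillation of a function of finitely many spins is at most the sum of the single-site
oscillations. -/
theorem abs_sub_le_sum_of_dependsOn {f : (V → S) → ℝ} {Λ : Finset V} (hΛ : DependsOn f (Λ : Set V))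
    {δ : V → ℝ} (hδ : ∀ j ω t, |f (update ω j t) - f ω| ≤ δ j) (ω ω' : V → S) :
    |f ω - f ω'| ≤ ∑ j ∈ Λ, δ j := by
  classical
  -- Interpolation: the sites of `T` are switched from `ω'` to `ω` one at a time. At `T = Λ` the
  -- function no longer distinguishes the result from `ω`.
  have key : ∀ T : Finset V, |f (T.piecewise ω ω') - f ω'| ≤ ∑ j ∈ T, δ j := by
    intro T
    induction T using Finset.induction_on with
    | empty => simp
    | insert i T hi ih =>
      rw [Finset.sum_insert hi, Finset.piecewise_insert]
      have h1 := hδ i (T.piecewise ω ω') (ω i)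
      have h2 := abs_sub_le (f (update (T.piecewise ω ω') i (ω i))) (f (T.piecewise ω ω')) (f ω')
      linarith
  have h : f ω = f (Λ.piecewise ω ω') := hΛ fun i hi => by
    rw [Finset.piecewise_eq_of_mem _ _ _ (Finset.mem_coe.1 hi)]
  rw [h]; exact key Λ

/-- The coefficients `a` bound the difference of the expectations of local functions under `ν₁`
and `ν₂` in terms of their single-site oscillations. -/
def IsComparison (ν₁ ν₂ : Measure (V → S)) (a : V → ℝ) : Prop :=
  ∀ (f : (V → S) → ℝ) (Λ : Finset V) (δ : V → ℝ), Measurable f → DependsOn f (Λ : Set V) →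
    (∀ j ω t, |f (update ω j t) - f ω| ≤ δ j) →
    |∫ ω, f ω ∂ν₁ - ∫ ω, f ω ∂ν₂| ≤ ∑ j ∈ Λ, a j * δ j

variable {ν₁ ν₂ : Measure (V → S)} [IsProbabilityMeasure ν₁] [IsProbabilityMeasure ν₂]

theorem exists_bound_of_dependsOn {f : (V → S) → ℝ} {Λ : Finset V} (hΛ : DependsOn f (Λ : Set V))
    {δ : V → ℝ} (hδ : ∀ j ω t, |f (update ω j t) - f ω| ≤ δ j) : ∃ C, ∀ ω, |f ω| ≤ C := by
  rcases isEmpty_or_nonempty (V → S) with h | ⟨⟨ω₀⟩⟩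
  · exact ⟨0, fun ω => h.elim ω⟩
  · refine ⟨∑ j ∈ Λ, δ j + |f ω₀|, fun ω => ?_⟩
    have h1 := abs_sub_le_sum_of_dependsOn hΛ hδ ω ω₀
    have h2 := abs_add_le (f ω - f ω₀) (f ω₀)
    have h3 : f ω - f ω₀ + f ω₀ = f ω := by ring
    rw [h3] at h2; linarith

/-- The starting point of the iteration: each expectation is within `∑ δ j` of the single value `f
ω₀`, hence the constant 2. -/
theorem isComparison_two : IsComparison ν₁ ν₂ (fun _ => (2 : ℝ)) := by
  intro f Λ δ hf hΛ hδ
  obtain ⟨ω₀⟩ : Nonempty (V → S) := nonempty_of_isProbabilityMeasure ν₁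
  obtain ⟨C, hC⟩ := exists_bound_of_dependsOn hΛ hδ
  have h : ∀ (ν : Measure (V → S)) [IsProbabilityMeasure ν],
      |∫ ω, f ω ∂ν - f ω₀| ≤ ∑ j ∈ Λ, δ j := by
    intro ν _
    have hi : Integrable f ν := Integrable.of_bound hf.aestronglyMeasurable C (ae_of_all _ hC)
    have h1 : ∫ ω, f ω ∂ν - f ω₀ = ∫ ω, (f ω - f ω₀) ∂ν := by
      rw [integral_sub hi (integrable_const _)]; simp
    rw [h1]
    have := norm_integral_le_of_norm_le_const (μ := ν) (f := fun ω => f ω - f ω₀)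
      (ae_of_all _ fun ω => abs_sub_le_sum_of_dependsOn hΛ hδ ω ω₀)
    simpa using this
  rw [← Finset.mul_sum]
  have h1 := abs_le.1 (h ν₁)
  have h2 := abs_le.1 (h ν₂)
  exact abs_le.2 ⟨by linarith, by linarith⟩

theorem nonneg_of_oscillation [Nonempty (V → S)] {f : (V → S) → ℝ} {δ : V → ℝ}
    (hδ : ∀ j ω t, |f (update ω j t) - f ω| ≤ δ j) (j : V) : 0 ≤ δ j :=
  let ω : V → S := Classical.arbitrary _
  (abs_nonneg _).trans (hδ j ω (ω j))

theorem IsComparison.mono {a b : V → ℝ} (ha : IsComparison ν₁ ν₂ a) (hab : ∀ j, a j ≤ b j) :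
    IsComparison ν₁ ν₂ b := by
  intro f Λ δ hf hΛ hδ
  have : Nonempty (V → S) := nonempty_of_isProbabilityMeasure ν₁
  exact (ha f Λ δ hf hΛ hδ).trans (Finset.sum_le_sum fun j _ =>
    mul_le_mul_of_nonneg_right (hab j) (nonneg_of_oscillation hδ j))

variable {N : V → Finset V} {c : ℝ} {p : V → (V → S) → S → ℝ}

/-- The single-site oscillations of `siteAverage l p i f`. -/
theorem oscillation_siteAverage [SFinite l] (hp : IsSingleSiteSpec l N c p) (i : V)
    {f : (V → S) → ℝ} (hf : Measurable f) {C : ℝ} (hC : ∀ ω, |f ω| ≤ C) {δ : V → ℝ}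
    (hδ : ∀ j ω t, |f (update ω j t) - f ω| ≤ δ j) (j : V) (ω : V → S) (u : S) :
    |siteAverage l p i f (update ω j u) - siteAverage l p i f ω| ≤
      if j = i then 0 else δ j + if j ∈ N i then c * δ i else 0 := by
  have hfm : ∀ ω, Measurable fun t => f (update ω i t) := fun ω =>
    hf.comp ((measurable_update_uncurry i).comp measurable_prodMk_left)
  have hpf : ∀ ω ω', Integrable (fun t => p i ω t * f (update ω' i t)) l := fun ω ω' =>
    (hp.integrable i ω).mul_bdd (c := C) (hfm ω').aestronglyMeasurable (ae_of_all _ fun t => hC _)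
  split_ifs with hji hjN
  · subst hji
    have h1 : p j (update ω j u) = p j ω := hp.dependsOn j fun x hx => by
      have : x ≠ j := by rintro rfl; exact hp.notMem _ (Finset.mem_coe.1 hx)
      simp [update_of_ne this]
    simp [siteAverage, h1]
  all_goals
    -- The spin at `j` acts in two ways: through the argument of `f`, which costs `δ j`, and through
    -- the density, which costs at most `c * δ i` and only if `j` is a neighbour of `i`.
    have hsplit : siteAverage l p i f (update ω j u) - siteAverage l p i f ω =
        ∫ t, p i (update ω j u) t * (f (update (update ω j u) i t) - f (update ω i t)) ∂l +
        (∫ t, p i (update ω j u) t * f (update ω i t) ∂l - ∫ t, p i ω t * f (update ω i t) ∂l) := by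
      simp only [siteAverage, mul_sub]
      rw [integral_sub (hpf _ _) (hpf _ _)]; ring
    have hfirst : |∫ t, p i (update ω j u) t *
        (f (update (update ω j u) i t) - f (update ω i t)) ∂l| ≤ δ j := by
      calc _ ≤ ∫ t, |p i (update ω j u) t *
            (f (update (update ω j u) i t) - f (update ω i t))| ∂l := abs_integral_le_integral_abs
        _ ≤ ∫ t, p i (update ω j u) t * δ j ∂l := by
          refine integral_mono_of_nonneg (ae_of_all _ fun s => abs_nonneg _)
            ((hp.integrable i _).mul_const _) (ae_of_all _ fun s => ?_)
          simp only [abs_mul, abs_of_nonneg (hp.nonneg i _ s)]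
          rw [update_comm hji]
          exact mul_le_mul_of_nonneg_left (hδ _ _ _) (hp.nonneg i _ s)
        _ = δ j := by rw [integral_mul_const, hp.integral_eq_one, one_mul]
    rw [hsplit]
    refine (abs_add_le _ _).trans (add_le_add hfirst ?_)
  · refine abs_integral_mul_sub_le (hp.nonneg i ω) (hp.integral_eq_one i ω)
      (hp.integral_eq_one i _) (hp.ratio i ω j u) (hfm ω) fun s s' => ?_
    have := hδ i (update ω i s') s
    simpa using this
  · have h1 : p i (update ω j u) = p i ω := hp.dependsOn i fun x hx => by
      have : x ≠ j := fun h => hjN (h ▸ Finset.mem_coe.1 hx)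
      simp [update_of_ne this]
    simp [h1]

/-- One step of Dobrushin's comparison argument. -/
theorem IsComparison.update [SFinite l] (hp : IsSingleSiteSpec l N c p)
    (h₁ : IsSingleSiteGibbs l p ν₁) (h₂ : IsSingleSiteGibbs l p ν₂) {a : V → ℝ}
    (ha : IsComparison ν₁ ν₂ a) (i : V) :
    IsComparison ν₁ ν₂ (update a i (c * ∑ j ∈ N i, a j)) := by
  intro f Λ δ hf hΛ hδ
  by_cases hi : i ∈ Λ
  swap
  · refine (ha f Λ δ hf hΛ hδ).trans (le_of_eq (Finset.sum_congr rfl fun j hj => ?_))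
    have hji : j ≠ i := by rintro rfl; exact hi hj
    rw [update_of_ne hji]
  obtain ⟨C, hC⟩ := exists_bound_of_dependsOn hΛ hδ
  -- The averaged function also depends on the sites of `N i` outside `Λ`. There `f` itself does not
  -- oscillate, so truncating `δ` keeps those sites from contributing more than `c * δ i`.
  set δ' : V → ℝ := fun j => if j ∈ Λ then δ j else 0 with hδ'
  have hδ'f : ∀ j ω t, |f (Function.update ω j t) - f ω| ≤ δ' j := by
    intro j ω t
    simp only [hδ']
    split_ifs with hj
    · exact hδ j ω t
    · have h : f (Function.update ω j t) = f ω := hΛ fun x hx => by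
        have hxj : x ≠ j := by rintro rfl; exact hj (Finset.mem_coe.1 hx)
        rw [update_of_ne hxj]
      simp [h]
  have hdep : DependsOn (siteAverage l p i f) ((Λ ∪ N i : Finset V) : Set V) := by
    intro x y hxy
    have e1 : p i x = p i y := hp.dependsOn i fun j hj => hxy j (by
      rw [Finset.mem_coe] at hj ⊢; exact Finset.mem_union_right _ hj)
    have e2 : ∀ t, f (Function.update x i t) = f (Function.update y i t) := fun t =>
      hΛ fun j hj => by
        by_cases h : j = i
        · subst h; simp
        · rw [update_of_ne h, update_of_ne h]
          exact hxy j (by rw [Finset.mem_coe] at hj ⊢; exact Finset.mem_union_left _ hj)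
    simp only [siteAverage, e1, e2]
  -- Averaging at `i` leaves both expectations unchanged but removes the oscillation at `i`, passing
  -- `c * δ i` on to each neighbour. Collecting the terms in `δ i` gives the new coefficient at `i`.
  have h := ha (siteAverage l p i f) (Λ ∪ N i) _ (measurable_siteAverage hp i hf) hdep
    (oscillation_siteAverage hp i hf hC hδ'f)
  rw [h₁.integral_siteAverage hp i hf hΛ hC, h₂.integral_siteAverage hp i hf hΛ hC] at h
  refine h.trans (le_of_eq ?_)
  have e1 : ∀ j, (a j * if j = i then 0 else δ' j + if j ∈ N i then c * δ' i else 0) =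
      (if j ∈ Λ.erase i then a j * δ j else 0) + (if j ∈ N i then a j * (c * δ i) else 0) := by
    intro j
    have hii := hp.notMem i
    by_cases hji : j = i
    · subst hji; simp [hii]
    · simp only [hji, if_false, hδ', hi, if_true, Finset.mem_erase, ne_eq, not_false_eq_true,
        true_and]
      split_ifs <;> ring
  simp_rw [e1]
  rw [Finset.sum_add_distrib, Finset.sum_ite_mem, Finset.sum_ite_mem,
    Finset.inter_eq_right.2 Finset.subset_union_right,
    Finset.inter_eq_right.2 ((Finset.erase_subset _ _).trans Finset.subset_union_left),
    ← Finset.add_sum_erase _ _ hi, update_self, Finset.mul_sum, Finset.sum_mul, add_comm]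
  congr 1
  · exact Finset.sum_congr rfl fun j _ => by ring
  · exact Finset.sum_congr rfl fun j hj => by rw [update_of_ne (Finset.ne_of_mem_erase hj)]

/-- One sweep of updates. Sites already visited carry `α * A ≤ A`, so each new coefficient is at
most `card * c * A ≤ α * A`. For a given `f` only the coefficients on `Λ` count, so sweeping the
finite set `Λ` is enough. -/
theorem IsComparison.mul_const [SFinite l] (hp : IsSingleSiteSpec l N c p) (hc : 0 ≤ c)
    (h₁ : IsSingleSiteGibbs l p ν₁) (h₂ : IsSingleSiteGibbs l p ν₂) {α : ℝ}
    (hα : ∀ i, (N i).card * c ≤ α) (hα1 : α ≤ 1) {A : ℝ} (hA : 0 ≤ A)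
    (ha : IsComparison ν₁ ν₂ (fun _ => A)) : IsComparison ν₁ ν₂ (fun _ => α * A) := by
  classical
  have key : ∀ T : Finset V, IsComparison ν₁ ν₂ (fun j => if j ∈ T then α * A else A) := by
    intro T
    induction T using Finset.induction_on with
    | empty => simpa using ha
    | insert i T hi ih =>
      refine (ih.update hp h₁ h₂ i).mono fun j => ?_
      by_cases hji : j = i
      · subst hji
        rw [update_self, if_pos (Finset.mem_insert_self _ _)]
        calc _ ≤ c * ∑ x ∈ N j, A := by
              refine mul_le_mul_of_nonneg_left (Finset.sum_le_sum fun x _ => ?_) hc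
              split_ifs
              · nlinarith
              · exact le_rfl
          _ = ((N j).card * c) * A := by rw [Finset.sum_const, nsmul_eq_mul]; ring
          _ ≤ α * A := mul_le_mul_of_nonneg_right (hα j) hA
      · rw [update_of_ne hji]
        simp [Finset.mem_insert, hji]
  intro f Λ δ hf hΛ hδ
  refine (key Λ f Λ δ hf hΛ hδ).trans (le_of_eq (Finset.sum_congr rfl fun j hj => ?_))
  simp only [if_pos hj]

/-- **Dobrushin's uniqueness theorem**, for single-site conditional densities of finite range. -/
theorem IsSingleSiteSpec.unique [SFinite l] (hp : IsSingleSiteSpec l N c p) (hc : 0 ≤ c)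
    (h₁ : IsSingleSiteGibbs l p ν₁) (h₂ : IsSingleSiteGibbs l p ν₂) {α : ℝ} (hα0 : 0 ≤ α)
    (hα : ∀ i, (N i).card * c ≤ α) (hα1 : α < 1) : ν₁ = ν₂ := by
  -- Each sweep gains a factor `α < 1`. In the limit the measures agree on cylinder events, whose
  -- indicators have single-site oscillations at most 1, and these form a generating π-system.
  have hn : ∀ n : ℕ, IsComparison ν₁ ν₂ (fun _ => α ^ n * 2) := by
    intro n
    induction n with
    | zero => simpa using isComparison_two
    | succ n ih =>
      have := ih.mul_const hp hc h₁ h₂ hα hα1.le (by positivity)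
      simpa only [pow_succ', mul_assoc] using this
  have hcyl : ∀ s ∈ measurableCylinders (fun _ : V => S), ν₁ s = ν₂ s := by
    intro s hs
    obtain ⟨Λ, T, hT, rfl⟩ := (mem_measurableCylinders s).1 hs
    set f : (V → S) → ℝ := (cylinder (α := fun _ : V => S) Λ T).indicator (fun _ => 1) with hf
    have hms : MeasurableSet (cylinder (α := fun _ : V => S) Λ T) := .of_mem_measurableCylinders hs
    have hfm : Measurable f := measurable_const.indicator hms
    have hdep : DependsOn f (Λ : Set V) := dependsOn_cylinder_indicator_const (α := fun _ : V => S) T 1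
    have hosc : ∀ j ω t, |f (Function.update ω j t) - f ω| ≤ (fun _ => (1 : ℝ)) j := by
      intro j ω t
      have h01 : ∀ ω, 0 ≤ f ω ∧ f ω ≤ 1 := fun ω =>
        ⟨Set.indicator_nonneg (fun _ _ => zero_le_one) ω,
          Set.indicator_le' (fun _ _ => le_rfl) (fun _ _ => zero_le_one) ω⟩
      exact abs_le.2 ⟨by linarith [h01 ω, h01 (Function.update ω j t)],
        by linarith [h01 ω, h01 (Function.update ω j t)]⟩
    have hle : ∀ n : ℕ, |∫ ω, f ω ∂ν₁ - ∫ ω, f ω ∂ν₂| ≤ α ^ n * (2 * Λ.card) := by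
      intro n
      have := hn n f Λ _ hfm hdep hosc
      simp only [mul_one, Finset.sum_const, nsmul_eq_mul] at this
      linarith
    have hlim : Filter.Tendsto (fun n : ℕ => α ^ n * (2 * (Λ.card : ℝ))) Filter.atTop (nhds 0) := by
      have := (tendsto_pow_atTop_nhds_zero_of_lt_one hα0 hα1).mul_const (2 * (Λ.card : ℝ))
      simpa using this
    have h0 := ge_of_tendsto' hlim hle
    have h1 : ∫ ω, f ω ∂ν₁ = ∫ ω, f ω ∂ν₂ :=
      sub_eq_zero.1 (abs_eq_zero.1 (le_antisymm h0 (abs_nonneg _)))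
    rw [hf, integral_indicator_const _ hms, integral_indicator_const _ hms] at h1
    simp only [smul_eq_mul, mul_one] at h1
    exact (measureReal_eq_measureReal_iff).1 h1
  exact ext_of_generate_finite _ generateFrom_measurableCylinders.symm
    isPiSystem_measurableCylinders hcyl (by simp)

end Dobrushin

/-! ### Orientation of edges, balls and spheres -/

section Tree

variable {V : Type*} {G : SimpleGraph V}

theorem IsSucc.not_symm {x₀ x y : V} (hG : G.Connected) (h : IsSucc G x₀ x y) :
    ¬ IsSucc G x₀ y x := by
  rintro ⟨-, h'⟩
  have h1 := h.2
  rw [← (hG x₀ x).coe_dist_eq_edist, ← (hG x₀ y).coe_dist_eq_edist] at h1 h'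
  norm_cast at h1 h'
  omega

theorem isSucc_or_isSucc (hG : G.IsTree) (x₀ : V) {x y : V} (h : G.Adj x y) :
    IsSucc G x₀ x y ∨ IsSucc G x₀ y x := by
  have hc := hG.connected
  simp only [IsSucc, h, h.symm, true_and]
  rw [← (hc x₀ x).coe_dist_eq_edist, ← (hc x₀ y).coe_dist_eq_edist]
  norm_cast
  rcases hG.dist_eq_dist_add_one_of_adj x₀ h with h1 | h1
  · exact Or.inr h1
  · exact Or.inl h1

theorem not_isSucc_self (x₀ x : V) : ¬ IsSucc G x₀ x x := fun h => G.irrefl h.1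

theorem ball_mono (x₀ : V) {n n' : ℕ} (h : n ≤ n') : ball G x₀ n ⊆ ball G x₀ n' := by
  intro x hx
  have hx' : G.edist x₀ x ≤ n := hx
  exact hx'.trans (by exact_mod_cast h)

theorem exists_subset_ball (hG : G.Connected) (x₀ : V) (Λ : Finset V) :
    ∃ n : ℕ, 1 ≤ n ∧ (Λ : Set V) ⊆ ball G x₀ n := by
  refine ⟨Λ.sup (G.dist x₀) + 1, by omega, fun x hx => ?_⟩
  have h1 : G.dist x₀ x ≤ Λ.sup (G.dist x₀) := Finset.le_sup (f := G.dist x₀) hx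
  have h2 : G.edist x₀ x = (G.dist x₀ x : ℕ) := (hG x₀ x).coe_dist_eq_edist.symm
  change G.edist x₀ x ≤ _
  rw [h2]
  exact_mod_cast h1.trans (Nat.le_succ _)

theorem disjoint_ball_sphere (x₀ : V) (n : ℕ) {x : V} (h : x ∈ ball G x₀ n) :
    x ∉ sphere G x₀ (n + 1) := by
  intro h'
  have h1 : G.edist x₀ x ≤ n := h
  have h2 : G.edist x₀ x = (n + 1 : ℕ) := h'
  rw [h2] at h1
  norm_cast at h1
  omega

end Tree

/-! ### Resampling a coordinate of a product measure -/

section PiMeasure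

open Function

/-- Resampling one coordinate preserves a product of probability measures. -/
theorem measurePreserving_update {ι S : Type*} [Fintype ι] [DecidableEq ι] [MeasurableSpace S]
    (l : Measure S) [IsProbabilityMeasure l] (i : ι) :
    MeasurePreserving (fun x : (ι → S) × S => update x.1 i x.2)
      ((Measure.pi fun _ => l).prod l) (Measure.pi fun _ => l) := by
  refine ⟨measurable_update_uncurry i, (Measure.pi_eq fun s hs => ?_).symm⟩
  rw [Measure.map_apply (measurable_update_uncurry i) (MeasurableSet.univ_pi hs)]
  have h : (fun x : (ι → S) × S => update x.1 i x.2) ⁻¹' Set.univ.pi s =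
      Set.univ.pi (update s i Set.univ) ×ˢ s i := by
    ext ⟨σ, t⟩
    simp only [Set.mem_preimage, Set.mem_univ_pi, Set.mem_prod]
    constructor
    · intro h
      refine ⟨fun j => ?_, by simpa using h i⟩
      by_cases hj : j = i
      · subst hj; simp
      · simpa [update_of_ne hj] using h j
    · rintro ⟨h1, h2⟩ j
      by_cases hj : j = i
      · subst hj; simpa using h2
      · simpa [update_of_ne hj] using h1 j
  rw [h, Measure.prod_prod, Measure.pi_pi, ← Finset.mul_prod_erase _ _ (Finset.mem_univ i),
    ← Finset.mul_prod_erase _ (fun j => l (s j)) (Finset.mem_univ i)]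
  simp only [update_self, measure_univ, one_mul]
  rw [mul_comm]
  congr 1
  exact Finset.prod_congr rfl fun j hj => by rw [update_of_ne (Finset.ne_of_mem_erase hj)]

theorem lintegral_lintegral_update {ι S : Type*} [Fintype ι] [DecidableEq ι] [MeasureSpace S]
    [IsProbabilityMeasure (volume : Measure S)] (i : ι) {H : (ι → S) → ENNReal}
    (hH : Measurable H) : ∫⁻ σ, ∫⁻ t, H (update σ i t) = ∫⁻ σ, H σ := by
  have h := measurePreserving_update (volume : Measure S) i
  rw [volume_pi, ← h.lintegral_comp hH]
  exact (lintegral_prod _ (hH.comp (measurable_update_uncurry i)).aemeasurable).symm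

end PiMeasure

/-! ### Single-site weights and the local change of energy -/

section SingleSite

open Function Classical

variable {V : Type*} {G : SimpleGraph V} [G.LocallyFinite] {K : unitInterval → unitInterval → ℝ}
  {x₀ : V}

variable (G K x₀) in
/-- Minus the energy of the edges at `i` when the spin at `i` is `t`. -/
def siteLogWeight (i : V) (ω : Config V) (t : unitInterval) : ℝ :=
  ∑ j ∈ G.neighborFinset i,
    if IsSucc G x₀ i j then Real.log (K t (ω j)) else Real.log (K (ω j) t)

variable (G K x₀) in
/-- The conditional density of the spin at `i` given all other spins. -/
def siteDensity (i : V) (ω : Config V) (t : unitInterval) : ℝ :=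
  Real.exp (siteLogWeight G K x₀ i ω t) / ∫ s, Real.exp (siteLogWeight G K x₀ i ω s)

/-- A configuration on a ball, extended by `0`. -/
def extend {n : ℕ} (σ : ball G x₀ n → unitInterval) : Config V :=
  fun x => if h : x ∈ ball G x₀ n then σ ⟨x, h⟩ else 0

theorem extend_apply {n : ℕ} (σ : ball G x₀ n → unitInterval) (x : ball G x₀ n) :
    extend σ x = σ x := by
  simp [extend]

theorem extend_domRestrict {n : ℕ} (ω : Config V) {x : V} (hx : x ∈ ball G x₀ n) :
    extend (Set.domRestrict (ball G x₀ n) ω) x = ω x := by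
  simp [extend, hx]

theorem domRestrict_extend {n : ℕ} (σ : ball G x₀ n → unitInterval) :
    Set.domRestrict (ball G x₀ n) (extend σ) = σ :=
  funext fun x => extend_apply σ x

theorem extend_update {n : ℕ} (σ : ball G x₀ n → unitInterval) (i : ball G x₀ n)
    (t : unitInterval) : extend (update σ i t) = update (extend σ) i t := by
  funext x
  by_cases hx : x = i
  · subst hx
    rw [extend_apply, update_self, update_self]
  · rw [update_of_ne hx]
    simp only [extend]
    split_ifs with h
    · rw [update_of_ne]
      intro h'
      exact hx (congrArg Subtype.val h')
    · rfl

theorem measurable_extend {n : ℕ} :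
    Measurable (extend : (ball G x₀ n → unitInterval) → Config V) := by
  refine measurable_pi_lambda _ fun x => ?_
  simp only [extend]
  split_ifs with h
  · exact measurable_pi_apply _
  · exact measurable_const

/-- The matrix `D` lives on the cross formed by row and column `i`. Applied to the change of energy,
this leaves the edges at `i`, in either orientation. -/
theorem sum_sum_eq_of_support {B : Type*} [Fintype B] (i : B) (D : B → B → ℝ)
    (h0 : D i i = 0) (h : ∀ x y, x ≠ i → y ≠ i → D x y = 0) :
    ∑ x, ∑ y, D x y = ∑ y, (D i y + D y i) := by
  have h1 : ∀ x y, D x y = (if x = i then D i y else 0) + (if y = i then D x i else 0) := by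
    intro x y
    by_cases hx : x = i <;> by_cases hy : y = i
    · subst hx; subst hy; simp [h0]
    · subst hx; simp [hy]
    · subst hy; simp [hx]
    · simp [hx, hy, h x y hx hy]
  calc _ = ∑ x, ∑ y, ((if x = i then D i y else 0) + (if y = i then D x i else 0)) :=
        Finset.sum_congr rfl fun x _ => Finset.sum_congr rfl fun y _ => h1 x y
    _ = _ := by
      simp only [Finset.sum_add_distrib, Finset.sum_ite_eq', Finset.mem_univ, if_true]
      congr 1
      rw [Finset.sum_comm]
      simp

/-- The change of energy when the spin at `i` is changed. -/
theorem energy_update (hG : G.IsTree) {n : ℕ} (σ : ball G x₀ n → unitInterval) (i : ball G x₀ n)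
    (hN : ∀ j, G.Adj i j → j ∈ ball G x₀ n) (t : unitInterval) :
    energy G K x₀ n (update σ i t) + siteLogWeight G K x₀ i (extend σ) t =
      energy G K x₀ n σ + siteLogWeight G K x₀ i (extend σ) (σ i) := by
  set D : ball G x₀ n → ball G x₀ n → ℝ := fun x y =>
    (if IsSucc G x₀ x y then Real.log (K (update σ i t x) (update σ i t y)) else 0) -
      (if IsSucc G x₀ x y then Real.log (K (σ x) (σ y)) else 0) with hD
  have h1 : energy G K x₀ n σ - energy G K x₀ n (update σ i t) = ∑ x, ∑ y, D x y := by
    simp only [energy, hD, Finset.sum_sub_distrib]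
    ring
  have h2 : ∑ x, ∑ y, D x y = ∑ y, (D i y + D y i) := by
    refine sum_sum_eq_of_support i D ?_ fun x y hx hy => ?_
    · simp [hD, not_isSucc_self]
    · simp [hD, update_of_ne hx, update_of_ne hy]
  have h3 : siteLogWeight G K x₀ i (extend σ) t - siteLogWeight G K x₀ i (extend σ) (σ i) =
      ∑ y, (D i y + D y i) := by
    -- Setting the summand to zero off the neighbours of `i` extends it to all of `V`, so that the
    -- sums over the ball and over the neighbours can be identified; `hN` ensures that no neighbour
    -- is lost.
    set φ : V → ℝ := fun j => if G.Adj i j then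
      ((if IsSucc G x₀ i j then Real.log (K t (extend σ j)) else Real.log (K (extend σ j) t)) -
      (if IsSucc G x₀ i j then Real.log (K (σ i) (extend σ j)) else
        Real.log (K (extend σ j) (σ i)))) else 0 with hφ
    have h4 : ∀ y : ball G x₀ n, D i y + D y i = φ y := by
      intro y
      simp only [hφ, hD]
      by_cases hadj : G.Adj i y
      · have hy : y ≠ i := by
          rintro rfl; exact G.irrefl hadj
        rw [if_pos hadj, update_self, update_of_ne hy, extend_apply]
        by_cases hs : IsSucc G x₀ i y
        · simp [hs, hs.not_symm hG.connected]
        · simp [hs, (isSucc_or_isSucc hG x₀ hadj).resolve_left hs]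
      · have e1 : ¬ IsSucc G x₀ i y := fun h => hadj h.1
        have e2 : ¬ IsSucc G x₀ y i := fun h => hadj h.1.symm
        simp [hadj, e1, e2]
    rw [Finset.sum_congr rfl fun y _ => h4 y, Finset.sum_set_coe (ball G x₀ n) (f := φ),
      siteLogWeight, siteLogWeight, ← Finset.sum_sub_distrib]
    refine Eq.trans ?_ (Finset.sum_subset (s₁ := G.neighborFinset i) ?_ ?_)
    · exact Finset.sum_congr rfl fun j hj => by
        rw [SimpleGraph.mem_neighborFinset] at hj; simp [hφ, hj]
    · intro j hj
      rw [SimpleGraph.mem_neighborFinset] at hj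
      simpa using hN j hj
    · intro j _ hj
      rw [SimpleGraph.mem_neighborFinset] at hj
      simp [hφ, hj]
  linarith

/-- The boundary energy does not depend on the spins off the inner boundary. -/
theorem boundaryEnergy_update {n : ℕ} (σ : ball G x₀ n → unitInterval) (i : ball G x₀ n)
    (hN : ∀ j, G.Adj i j → j ∈ ball G x₀ n) (t : unitInterval) (ω : Config V) :
    boundaryEnergy G K x₀ n (update σ i t) ω = boundaryEnergy G K x₀ n σ ω := by
  simp only [boundaryEnergy]
  congr 1
  refine Finset.sum_congr rfl fun x _ => Finset.sum_congr rfl fun y _ => ?_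
  by_cases hx : x = i
  · subst hx
    have : ¬ IsSucc G x₀ x y := fun h => disjoint_ball_sphere x₀ n (hN y h.1) y.2
    simp [this]
  · rw [update_of_ne hx]

/-- For an interior site the boundary energy does not see the spin at `i` and the normalizer does
not involve `σ`, so the density is proportional to the site weight. The cross-multiplied form is
linear in the density and survives averaging over `ω`. -/
theorem gibbsDensity_update (hG : G.IsTree) {n : ℕ} (σ : ball G x₀ n → unitInterval)
    (i : ball G x₀ n) (hN : ∀ j, G.Adj i j → j ∈ ball G x₀ n) (s t : unitInterval)
    (ω : Config V) :
    gibbsDensity G K x₀ n ω (update σ i t) * Real.exp (siteLogWeight G K x₀ i (extend σ) s) =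
      gibbsDensity G K x₀ n ω (update σ i s) * Real.exp (siteLogWeight G K x₀ i (extend σ) t) := by
  simp only [gibbsDensity, div_mul_eq_mul_div, ← Real.exp_add, boundaryEnergy_update σ i hN]
  have h1 := energy_update (K := K) hG σ i hN t
  have h2 := energy_update (K := K) hG σ i hN s
  congr 2
  linarith

end SingleSite

/-! ### The Dobrushin coefficient of the single-site densities -/

section SingleSiteSpec

open Function Classical

variable {V : Type*} {G : SimpleGraph V} [G.LocallyFinite] {K : unitInterval → unitInterval → ℝ}
  {x₀ : V}

theorem continuous_log_interaction
    (hKcont : Continuous (fun p : unitInterval × unitInterval => K p.1 p.2))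
    (hKpos : ∀ t u, 0 < K t u) {X : Type*} [TopologicalSpace X] {a b : X → unitInterval}
    (ha : Continuous a) (hb : Continuous b) : Continuous fun x => Real.log (K (a x) (b x)) :=
  (hKcont.comp (ha.prodMk hb)).log fun _ => (hKpos _ _).ne'

theorem measurable_log_interaction
    (hKcont : Continuous (fun p : unitInterval × unitInterval => K p.1 p.2))
    {X : Type*} [MeasurableSpace X] {a b : X → unitInterval}
    (ha : Measurable a) (hb : Measurable b) : Measurable fun x => Real.log (K (a x) (b x)) :=
  (hKcont.measurable.comp (ha.prodMk hb)).log

theorem integrable_of_continuous {X : Type*} [TopologicalSpace X] [CompactSpace X]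
    [MeasurableSpace X] [OpensMeasurableSpace X] {μ : Measure X} [IsFiniteMeasure μ] {f : X → ℝ}
    (hf : Continuous f) : Integrable f μ :=
  hf.integrable_of_hasCompactSupport (HasCompactSupport.of_compactSpace f)

theorem continuous_siteLogWeight
    (hKcont : Continuous (fun p : unitInterval × unitInterval => K p.1 p.2))
    (hKpos : ∀ t u, 0 < K t u) (i : V) (ω : Config V) :
    Continuous (siteLogWeight G K x₀ i ω) := by
  refine continuous_finsetSum _ fun j _ => ?_
  split_ifs
  · exact continuous_log_interaction hKcont hKpos continuous_id continuous_const
  · exact continuous_log_interaction hKcont hKpos continuous_const continuous_id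

theorem measurable_siteLogWeight
    (hKcont : Continuous (fun p : unitInterval × unitInterval => K p.1 p.2)) (i : V) :
    Measurable fun x : Config V × unitInterval => siteLogWeight G K x₀ i x.1 x.2 := by
  refine Finset.measurable_sum _ fun j _ => ?_
  split_ifs
  · exact measurable_log_interaction hKcont measurable_snd
      ((measurable_pi_apply j).comp measurable_fst)
  · exact measurable_log_interaction hKcont ((measurable_pi_apply j).comp measurable_fst)
      measurable_snd

theorem integrable_exp_siteLogWeight
    (hKcont : Continuous (fun p : unitInterval × unitInterval => K p.1 p.2))
    (hKpos : ∀ t u, 0 < K t u) (i : V) (ω : Config V) :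
    Integrable fun t => Real.exp (siteLogWeight G K x₀ i ω t) :=
  integrable_of_continuous (continuous_siteLogWeight hKcont hKpos i ω).rexp

theorem integral_exp_siteLogWeight_pos
    (hKcont : Continuous (fun p : unitInterval × unitInterval => K p.1 p.2))
    (hKpos : ∀ t u, 0 < K t u) (i : V) (ω : Config V) :
    0 < ∫ t, Real.exp (siteLogWeight G K x₀ i ω t) :=
  integral_exp_pos (integrable_exp_siteLogWeight hKcont hKpos i ω)

theorem measurable_siteDensity
    (hKcont : Continuous (fun p : unitInterval × unitInterval => K p.1 p.2)) (i : V) :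
    Measurable (uncurry (siteDensity G K x₀ i)) := by
  have h := (measurable_siteLogWeight (G := G) (x₀ := x₀) hKcont i).exp
  exact h.div (h.stronglyMeasurable.integral_prod_right'.measurable.comp measurable_fst)

theorem dependsOn_siteLogWeight (i : V) :
    DependsOn (siteLogWeight G K x₀ i) (G.neighborFinset i : Set V) := by
  intro ω ω' h
  funext t
  refine Finset.sum_congr rfl fun j hj => ?_
  rw [h j hj]

/-- At most one summand involves the spin at `j`, and `log K` takes values between `log m` and `log
M`. -/
theorem siteLogWeight_update_ge {m M : ℝ} (hm0 : 0 < m) (hm : ∀ t u, m ≤ K t u)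
    (hM : ∀ t u, K t u ≤ M) (i j : V) (ω : Config V) (u t : unitInterval) :
    siteLogWeight G K x₀ i ω t + (Real.log m - Real.log M) ≤
      siteLogWeight G K x₀ i (update ω j u) t := by
  have hlm : ∀ s s', Real.log m ≤ Real.log (K s s') := fun s s' => Real.log_le_log hm0 (hm s s')
  have hlM : ∀ s s', Real.log (K s s') ≤ Real.log M := fun s s' =>
    Real.log_le_log (hm0.trans_le (hm s s')) (hM s s')
  by_cases hj : j ∈ G.neighborFinset i
  · rw [siteLogWeight, siteLogWeight, ← Finset.add_sum_erase _ _ hj, ← Finset.add_sum_erase _ _ hj]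
    have h1 : ∀ x ∈ (G.neighborFinset i).erase j, update ω j u x = ω x := fun x hx =>
      update_of_ne (Finset.ne_of_mem_erase hx) _ _
    have h2 : ∑ x ∈ (G.neighborFinset i).erase j, (if IsSucc G x₀ i x then
          Real.log (K t (update ω j u x)) else Real.log (K (update ω j u x) t)) =
        ∑ x ∈ (G.neighborFinset i).erase j, (if IsSucc G x₀ i x then
          Real.log (K t (ω x)) else Real.log (K (ω x) t)) :=
      Finset.sum_congr rfl fun x hx => by rw [h1 x hx]
    rw [h2, update_self]
    split_ifs
    · linarith [hlm t u, hlM t (ω j)]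
    · linarith [hlm u t, hlM (ω j) t]
  · rw [dependsOn_siteLogWeight i (x := update ω j u) (y := ω) fun x hx => by
      have : x ≠ j := by rintro rfl; exact hj hx
      rw [update_of_ne this]]
    linarith [hlm 0 0, hlM 0 0]

/-- The square comes from using the factor `m / M` twice, once for the weight and once for the
normalizer. -/
theorem isSingleSiteSpec_siteDensity
    (hKcont : Continuous (fun p : unitInterval × unitInterval => K p.1 p.2)) {m M : ℝ}
    (hm0 : 0 < m) (hm : ∀ t u, m ≤ K t u) (hM : ∀ t u, K t u ≤ M) :
    IsSingleSiteSpec volume (fun i => G.neighborFinset i) (1 - (m / M) ^ 2) (siteDensity G K x₀) := by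
  have hKpos : ∀ t u, 0 < K t u := fun t u => hm0.trans_le (hm t u)
  have hM0 : 0 < M := (hKpos 0 0).trans_le (hM 0 0)
  have hZ := integral_exp_siteLogWeight_pos (G := G) (x₀ := x₀) hKcont hKpos
  refine ⟨fun i ω t => div_nonneg (Real.exp_pos _).le (hZ i ω).le, measurable_siteDensity hKcont,
    fun i ω => ?_, fun i ω ω' h => ?_, fun i hi => ?_, fun i ω j u t => ?_⟩
  · simp only [siteDensity]
    rw [integral_div, div_self (hZ i ω).ne']
  · funext t
    simp only [siteDensity, dependsOn_siteLogWeight i h]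
  · rw [SimpleGraph.mem_neighborFinset] at hi
    exact G.irrefl hi
  · have hq : Real.exp (Real.log m - Real.log M) = m / M := by
      rw [Real.exp_sub, Real.exp_log hm0, Real.exp_log hM0]
    have h1 : ∀ (ω : Config V) j u t, m / M * Real.exp (siteLogWeight G K x₀ i ω t) ≤
        Real.exp (siteLogWeight G K x₀ i (update ω j u) t) := by
      intro ω j u t
      rw [← hq, ← Real.exp_add, Real.exp_le_exp]
      linarith [siteLogWeight_update_ge (G := G) (x₀ := x₀) hm0 hm hM i j ω u t]
    have h2 : m / M * ∫ s, Real.exp (siteLogWeight G K x₀ i (update ω j u) s) ≤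
        ∫ s, Real.exp (siteLogWeight G K x₀ i ω s) := by
      rw [← integral_const_mul]
      refine integral_mono ((integrable_exp_siteLogWeight hKcont hKpos i _).const_mul _)
        (integrable_exp_siteLogWeight hKcont hKpos i _) fun s => ?_
      -- The bound on weights is applied in reverse, restoring the original spin at `j`.
      have := h1 (update ω j u) j (ω j) s
      rwa [update_idem, update_eq_self] at this
    have hq0 : 0 < m / M := div_pos hm0 hM0
    simp only [siteDensity, sub_sub_cancel]
    rw [mul_div_assoc', div_le_div_iff₀ (hZ i ω) (hZ i _)]
    calc _ = (m / M * Real.exp (siteLogWeight G K x₀ i ω t)) *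
          (m / M * ∫ s, Real.exp (siteLogWeight G K x₀ i (update ω j u) s)) := by ring
      _ ≤ _ := mul_le_mul (h1 ω j u t) h2 (mul_nonneg hq0.le (hZ i _).le) (Real.exp_pos _).le

end SingleSiteSpec

/-! ### From the DLR equations to single-site conditioning -/

section GibbsSingleSite

open Function Classical

variable {V : Type*} {G : SimpleGraph V} [G.LocallyFinite] {K : unitInterval → unitInterval → ℝ}
  {x₀ : V}

theorem continuous_energy
    (hKcont : Continuous (fun p : unitInterval × unitInterval => K p.1 p.2))
    (hKpos : ∀ t u, 0 < K t u) (n : ℕ) : Continuous (energy G K x₀ n) := by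
  refine (continuous_finsetSum _ fun x _ => continuous_finsetSum _ fun y _ => ?_).neg
  split_ifs
  · exact continuous_log_interaction hKcont hKpos (continuous_apply x) (continuous_apply y)
  · exact continuous_const

theorem continuous_boundaryEnergy
    (hKcont : Continuous (fun p : unitInterval × unitInterval => K p.1 p.2))
    (hKpos : ∀ t u, 0 < K t u) (n : ℕ) :
    Continuous fun x : Config V × (ball G x₀ n → unitInterval) =>
      boundaryEnergy G K x₀ n x.2 x.1 := by
  refine (continuous_finsetSum _ fun x _ => continuous_finsetSum _ fun y _ => ?_).neg
  split_ifs
  · exact continuous_log_interaction hKcont hKpos ((continuous_apply x).comp continuous_snd)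
      ((continuous_apply _).comp continuous_fst)
  · exact continuous_const

theorem measurable_boundaryEnergy
    (hKcont : Continuous (fun p : unitInterval × unitInterval => K p.1 p.2)) (n : ℕ) :
    Measurable fun x : Config V × (ball G x₀ n → unitInterval) =>
      boundaryEnergy G K x₀ n x.2 x.1 := by
  refine (Finset.measurable_sum _ fun x _ => Finset.measurable_sum _ fun y _ => ?_).neg
  split_ifs
  · exact measurable_log_interaction hKcont ((measurable_pi_apply x).comp measurable_snd)
      ((measurable_pi_apply _).comp measurable_fst)
  · exact measurable_const

theorem measurable_gibbsDensity
    (hKcont : Continuous (fun p : unitInterval × unitInterval => K p.1 p.2))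
    (hKpos : ∀ t u, 0 < K t u) (n : ℕ) :
    Measurable fun x : Config V × (ball G x₀ n → unitInterval) =>
      gibbsDensity G K x₀ n x.1 x.2 := by
  have h : Measurable fun x : Config V × (ball G x₀ n → unitInterval) =>
      Real.exp (-(energy G K x₀ n x.2 + boundaryEnergy G K x₀ n x.2 x.1)) :=
    (((continuous_energy hKcont hKpos n).measurable.comp measurable_snd).add
      (measurable_boundaryEnergy hKcont n)).neg.exp
  exact h.div (h.stronglyMeasurable.integral_prod_right'.measurable.comp measurable_fst)

theorem measurable_lintegral_gibbsDensity
    (hKcont : Continuous (fun p : unitInterval × unitInterval => K p.1 p.2))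
    (hKpos : ∀ t u, 0 < K t u) (n : ℕ) (ν : Measure (Config V)) [SFinite ν] :
    Measurable fun σ : ball G x₀ n → unitInterval =>
      ∫⁻ ω, ENNReal.ofReal (gibbsDensity G K x₀ n ω σ) ∂ν :=
  (measurable_gibbsDensity hKcont hKpos n).ennreal_ofReal.lintegral_prod_left'

theorem lintegral_eq_of_isGibbs {ν : Measure (Config V)} [SFinite ν]
    (hKcont : Continuous (fun p : unitInterval × unitInterval => K p.1 p.2))
    (hKpos : ∀ t u, 0 < K t u) (hν : IsGibbs G K x₀ ν) {n : ℕ} (hn : 1 ≤ n)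
    {f : Config V → ENNReal} (hf : Measurable f) (hdep : DependsOn f (ball G x₀ n)) :
    ∫⁻ ω, f ω ∂ν = ∫⁻ σ : ball G x₀ n → unitInterval,
      (∫⁻ ω, ENNReal.ofReal (gibbsDensity G K x₀ n ω σ) ∂ν) * f (extend σ) := by
  have h1 : ∀ ω, f ω = f (extend (Set.domRestrict (ball G x₀ n) ω)) := fun ω =>
    hdep fun x hx => (extend_domRestrict ω hx).symm
  have hfe : Measurable fun σ : ball G x₀ n → unitInterval => f (extend σ) :=
    hf.comp measurable_extend
  rw [lintegral_congr h1, ← lintegral_map hfe (Set.measurable_restrict _), hν n hn,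
    lintegral_withDensity_eq_lintegral_mul _
      (measurable_lintegral_gibbsDensity hKcont hKpos n ν) hfe]
  rfl

/-- If `D` has conditional density `P` in the coordinate `i`, then `F` may be replaced by its
conditional average. -/
theorem lintegral_mul_eq_of_conditional {ι S : Type*} [Fintype ι] [DecidableEq ι] [MeasureSpace S]
    [IsProbabilityMeasure (volume : Measure S)] (i : ι) {D F F' : (ι → S) → ENNReal}
    {P : (ι → S) → S → ENNReal} (hD : Measurable D) (hF : Measurable F) (hF' : Measurable F')
    (hP : ∀ σ, Measurable (P σ))
    (hfac : ∀ σ t, D (update σ i t) = (∫⁻ s, D (update σ i s)) * P σ t)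
    (hF'F : ∀ σ, F' σ = ∫⁻ t, P σ t * F (update σ i t))
    (hF'i : ∀ σ t, F' (update σ i t) = F' σ) :
    ∫⁻ σ, D σ * F σ = ∫⁻ σ, D σ * F' σ := by
  have hum : ∀ σ : ι → S, Measurable fun t => update σ i t := fun σ =>
    (measurable_update_uncurry i).comp measurable_prodMk_left
  have hDu : ∀ σ, Measurable fun t => D (update σ i t) := fun σ => hD.comp (hum σ)
  have hFu : ∀ σ, Measurable fun t => F (update σ i t) := fun σ => hF.comp (hum σ)
  have hDF : Measurable fun σ => D σ * F σ := hD.mul hF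
  have hDF' : Measurable fun σ => D σ * F' σ := hD.mul hF'
  -- After resampling coordinate `i`, `F'` is a constant for the inner integral, and both inner
  -- integrals equal the mass of `D` times the `P`-average of `F`.
  rw [← lintegral_lintegral_update i hDF, ← lintegral_lintegral_update i hDF']
  refine lintegral_congr fun σ => ?_
  simp only [hF'i]
  have h1 : ∀ t, D (update σ i t) * F (update σ i t) =
      (∫⁻ s, D (update σ i s)) * (P σ t * F (update σ i t)) := fun t => by
    rw [hfac σ t, mul_assoc]
  have h2 : Measurable fun t => P σ t * F (update σ i t) := (hP σ).mul (hFu σ)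
  rw [lintegral_mul_const _ (hDu σ), hF'F, lintegral_congr h1, lintegral_const_mul _ h2]

/-- The conditional densities of the averaged finite-volume Gibbs density. -/
theorem lintegral_gibbsDensity_update {ν : Measure (Config V)} [SFinite ν]
    (hKcont : Continuous (fun p : unitInterval × unitInterval => K p.1 p.2))
    (hKpos : ∀ t u, 0 < K t u) (hG : G.IsTree) {n : ℕ} (σ : ball G x₀ n → unitInterval)
    (i : ball G x₀ n) (hN : ∀ j, G.Adj i j → j ∈ ball G x₀ n) (t : unitInterval) :
    ∫⁻ ω, ENNReal.ofReal (gibbsDensity G K x₀ n ω (update σ i t)) ∂ν =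
      (∫⁻ s, ∫⁻ ω, ENNReal.ofReal (gibbsDensity G K x₀ n ω (update σ i s)) ∂ν) *
        ENNReal.ofReal (siteDensity G K x₀ i (extend σ) t) := by
  have hgd : ∀ s, Measurable fun ω => ENNReal.ofReal (gibbsDensity G K x₀ n ω (update σ i s)) :=
    fun s => ((measurable_gibbsDensity hKcont hKpos n).comp
      measurable_prodMk_right).ennreal_ofReal
  have hDu : Measurable fun s =>
      ∫⁻ ω, ENNReal.ofReal (gibbsDensity G K x₀ n ω (update σ i s)) ∂ν :=
    (measurable_lintegral_gibbsDensity hKcont hKpos n ν).comp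
      ((measurable_update_uncurry i).comp measurable_prodMk_left)
  have h1 : ∀ s, (∫⁻ ω, ENNReal.ofReal (gibbsDensity G K x₀ n ω (update σ i t)) ∂ν) *
        ENNReal.ofReal (Real.exp (siteLogWeight G K x₀ i (extend σ) s)) =
      (∫⁻ ω, ENNReal.ofReal (gibbsDensity G K x₀ n ω (update σ i s)) ∂ν) *
        ENNReal.ofReal (Real.exp (siteLogWeight G K x₀ i (extend σ) t)) := by
    intro s
    rw [← lintegral_mul_const _ (hgd t), ← lintegral_mul_const _ (hgd s)]
    refine lintegral_congr fun ω => ?_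
    rw [← ENNReal.ofReal_mul' (Real.exp_pos _).le, ← ENNReal.ofReal_mul' (Real.exp_pos _).le,
      gibbsDensity_update hG σ i hN s t ω]
  have hLm : Measurable fun s =>
      ENNReal.ofReal (Real.exp (siteLogWeight G K x₀ i (extend σ) s)) :=
    ((continuous_siteLogWeight hKcont hKpos i.1 (extend σ)).rexp.measurable).ennreal_ofReal
  have hZ : 0 < ∫ s, Real.exp (siteLogWeight G K x₀ i (extend σ) s) :=
    integral_exp_siteLogWeight_pos hKcont hKpos i.1 (extend σ)
  have hint : Integrable fun s => Real.exp (siteLogWeight G K x₀ i (extend σ) s) :=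
    integrable_exp_siteLogWeight hKcont hKpos i.1 (extend σ)
  -- Integrating the cross-multiplied identity over the spin `s` produces the normalizer of the site
  -- density on the left.
  have h2 : (∫⁻ ω, ENNReal.ofReal (gibbsDensity G K x₀ n ω (update σ i t)) ∂ν) *
        ENNReal.ofReal (∫ s, Real.exp (siteLogWeight G K x₀ i (extend σ) s)) =
      (∫⁻ s, ∫⁻ ω, ENNReal.ofReal (gibbsDensity G K x₀ n ω (update σ i s)) ∂ν) *
        ENNReal.ofReal (Real.exp (siteLogWeight G K x₀ i (extend σ) t)) := by
    have h3 : ENNReal.ofReal (∫ s, Real.exp (siteLogWeight G K x₀ i (extend σ) s)) =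
        ∫⁻ s, ENNReal.ofReal (Real.exp (siteLogWeight G K x₀ i (extend σ) s)) :=
      ofReal_integral_eq_lintegral_ofReal hint
        (ae_of_all _ fun s => (Real.exp_pos _).le)
    rw [h3, ← lintegral_const_mul _ hLm, ← lintegral_mul_const _ hDu]
    exact lintegral_congr h1
  rw [siteDensity, ENNReal.ofReal_div_of_pos hZ, mul_div_assoc', ← h2,
    ENNReal.mul_div_cancel_right (ENNReal.ofReal_pos.2 hZ).ne' ENNReal.ofReal_ne_top]

/-- A Gibbs measure is consistent with the single-site conditional densities. -/
theorem IsGibbs.isSingleSiteGibbs {ν : Measure (Config V)} [SFinite ν]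
    (hKcont : Continuous (fun p : unitInterval × unitInterval => K p.1 p.2))
    (hKpos : ∀ t u, 0 < K t u) (hG : G.IsTree) (hν : IsGibbs G K x₀ ν) :
    IsSingleSiteGibbs volume (siteDensity G K x₀) ν := by
  rintro i f hf ⟨Λ, hΛ⟩
  -- The ball contains the neighbours of `i` as well as `i` and `Λ`, which puts `i` off the inner
  -- boundary.
  obtain ⟨n, hn, hball⟩ := exists_subset_ball hG.connected x₀ (insert i (Λ ∪ G.neighborFinset i))
  have hsub : ∀ {j}, j ∈ insert i (Λ ∪ G.neighborFinset i) → j ∈ ball G x₀ n := fun h =>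
    hball (Finset.mem_coe.2 h)
  have hi : i ∈ ball G x₀ n := hsub (Finset.mem_insert_self _ _)
  have hΛb : ∀ j ∈ Λ, j ∈ ball G x₀ n := fun j hj =>
    hsub (Finset.mem_insert_of_mem (Finset.mem_union_left _ hj))
  have hNb : ∀ j ∈ G.neighborFinset i, j ∈ ball G x₀ n := fun j hj =>
    hsub (Finset.mem_insert_of_mem (Finset.mem_union_right _ hj))
  have hN : ∀ j, G.Adj i j → j ∈ ball G x₀ n := fun j hj =>
    hNb j ((SimpleGraph.mem_neighborFinset _ _ _).2 hj)
  have hpm := measurable_siteDensity (G := G) (x₀ := x₀) hKcont i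
  have hgm' : Measurable fun x : Config V × unitInterval =>
      ENNReal.ofReal (siteDensity G K x₀ i x.1 x.2) * f (update x.1 i x.2) :=
    hpm.ennreal_ofReal.mul (hf.comp (measurable_update_uncurry i))
  have hgm : Measurable fun ω : Config V =>
      ∫⁻ t, ENNReal.ofReal (siteDensity G K x₀ i ω t) * f (update ω i t) :=
    hgm'.lintegral_prod_right'
  have hgdep : DependsOn (fun ω : Config V =>
      ∫⁻ t, ENNReal.ofReal (siteDensity G K x₀ i ω t) * f (update ω i t))
      (ball G x₀ n \ {i}) := by
    intro ω ω' h
    have e1 : siteLogWeight G K x₀ i ω = siteLogWeight G K x₀ i ω' :=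
      dependsOn_siteLogWeight i fun j hj => h j ⟨hNb j hj, by
        rintro rfl
        exact G.irrefl ((SimpleGraph.mem_neighborFinset _ _ _).1 hj)⟩
    have e2 : ∀ t, f (update ω i t) = f (update ω' i t) := fun t => hΛ fun j hj => by
      by_cases hji : j = i
      · subst hji; simp
      · rw [update_of_ne hji, update_of_ne hji]
        exact h j ⟨hΛb j hj, hji⟩
    simp only [siteDensity, e1, e2]
  rw [lintegral_eq_of_isGibbs hKcont hKpos hν hn hf (hΛ.mono hΛb),
    lintegral_eq_of_isGibbs hKcont hKpos hν hn hgm (hgdep.mono Set.sdiff_subset)]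
  refine lintegral_mul_eq_of_conditional (⟨i, hi⟩ : ball G x₀ n)
    (P := fun σ t => ENNReal.ofReal (siteDensity G K x₀ i (extend σ) t))
    (measurable_lintegral_gibbsDensity hKcont hKpos n ν) (hf.comp measurable_extend)
    (hgm.comp measurable_extend) (fun σ => ?_)
    (fun σ t => lintegral_gibbsDensity_update hKcont hKpos hG σ _ hN t) (fun σ => ?_)
    (fun σ t => ?_)
  · exact (hpm.comp measurable_prodMk_left).ennreal_ofReal
  · simp only [extend_update]
  · exact hgdep fun j hj => by rw [extend_update, update_of_ne hj.2]

end GibbsSingleSite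

/-! ### Decomposing `V_{n+1}` into `V_n` and `W_{n+1}` -/

section Glue

theorem measurePreserving_sumElim {α β γ S : Type*} [Fintype α] [Fintype β] [Fintype γ]
    [MeasurableSpace S] (l : Measure S) [IsProbabilityMeasure l] (e : α ⊕ β ≃ γ) :
    MeasurePreserving (fun (x : (α → S) × (β → S)) (c : γ) => Sum.elim x.1 x.2 (e.symm c))
      ((Measure.pi fun _ => l).prod (Measure.pi fun _ => l)) (Measure.pi fun _ => l) := by
  have hm : Measurable (fun (x : (α → S) × (β → S)) (c : γ) => Sum.elim x.1 x.2 (e.symm c)) := by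
    refine measurable_pi_lambda _ fun c => ?_
    rcases e.symm c with a | b
    · exact (measurable_pi_apply a).comp measurable_fst
    · exact (measurable_pi_apply b).comp measurable_snd
  refine ⟨hm, (Measure.pi_eq fun s hs => ?_).symm⟩
  rw [Measure.map_apply hm (MeasurableSet.univ_pi hs)]
  have h : (fun (x : (α → S) × (β → S)) (c : γ) => Sum.elim x.1 x.2 (e.symm c)) ⁻¹'
      Set.univ.pi s = Set.univ.pi (fun a => s (e (Sum.inl a))) ×ˢ
        Set.univ.pi (fun b => s (e (Sum.inr b))) := by
    ext ⟨σ, τ⟩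
    simp only [Set.mem_preimage, Set.mem_univ_pi, Set.mem_prod]
    constructor
    · intro h
      exact ⟨fun a => by simpa using h (e (Sum.inl a)), fun b => by simpa using h (e (Sum.inr b))⟩
    · rintro ⟨h1, h2⟩ c
      obtain ⟨d, rfl⟩ := e.surjective c
      rcases d with a | b
      · simpa using h1 a
      · simpa using h2 b
  rw [h, Measure.prod_prod, Measure.pi_pi, Measure.pi_pi, ← e.prod_comp, Fintype.prod_sum_type]

/-- The first marginal of a measure with a density. -/
theorem map_withDensity_of_measurePreserving {A B C : Type*} [MeasurableSpace A]
    [MeasurableSpace B] [MeasurableSpace C] {a : Measure A} {b : Measure B} {c : Measure C}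
    [SFinite a] [SFinite b]
    {φ : A × B → C} (hφ : MeasurePreserving φ (a.prod b) c) {ρ : C → A} (hρ : Measurable ρ)
    (hρφ : ∀ x, ρ (φ x) = x.1) {D : C → ENNReal} (hD : Measurable D) :
    (c.withDensity D).map ρ = a.withDensity fun σ => ∫⁻ τ, D (φ (σ, τ)) ∂b := by
  refine Measure.ext_of_lintegral _ fun f hf => ?_
  have hDφ : Measurable fun x => D (φ x) := hD.comp hφ.measurable
  have h1 : Measurable fun x => D x * f (ρ x) := hD.mul (hf.comp hρ)
  have h2 : Measurable fun x => D (φ x) * f x.1 := hDφ.mul (hf.comp measurable_fst)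
  have h3 : Measurable fun x => f (ρ x) := hf.comp hρ
  rw [lintegral_map hf hρ, lintegral_withDensity_eq_lintegral_mul _ hD h3,
    lintegral_withDensity_eq_lintegral_mul _ hDφ.lintegral_prod_right' hf]
  simp only [Pi.mul_apply]
  rw [← hφ.lintegral_comp h1]
  simp only [hρφ]
  rw [lintegral_prod _ h2.aemeasurable]
  refine lintegral_congr fun σ => ?_
  have h4 : Measurable fun τ => D (φ (σ, τ)) := hDφ.comp measurable_prodMk_left
  exact lintegral_mul_const (f σ) h4

variable {V : Type*} (G : SimpleGraph V) (x₀ : V)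

theorem sphere_subset_ball (n : ℕ) : sphere G x₀ n ⊆ ball G x₀ n := fun _ hx => le_of_eq hx

theorem mem_ball_succ {G : SimpleGraph V} {x₀ : V} {n : ℕ} {x : V}
    (hx : x ∈ ball G x₀ (n + 1)) (h : x ∉ ball G x₀ n) : x ∈ sphere G x₀ (n + 1) := by
  have h1 : G.edist x₀ x ≤ (n + 1 : ℕ) := hx
  have h2 : ¬ G.edist x₀ x ≤ n := h
  change G.edist x₀ x = (n + 1 : ℕ)
  refine le_antisymm h1 ?_
  rw [not_le] at h2
  have := Order.add_one_le_of_lt h2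
  exact_mod_cast this

/-- `V_{n+1}` is the disjoint union of `V_n` and `W_{n+1}`. -/
def ballSuccEquiv (n : ℕ) : ball G x₀ n ⊕ sphere G x₀ (n + 1) ≃ ball G x₀ (n + 1) :=
  Equiv.ofBijective
    (Sum.elim (fun x => ⟨x, ball_mono x₀ n.le_succ x.2⟩)
      (fun y => ⟨y, sphere_subset_ball G x₀ (n + 1) y.2⟩)) <| by
    constructor
    · rintro (x | x) (y | y) h
      · have h' : (x : V) = y := congrArg (fun z : ball G x₀ (n + 1) => (z : V)) h
        exact congrArg Sum.inl (Subtype.ext h')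
      · have h' : (x : V) = y := congrArg (fun z : ball G x₀ (n + 1) => (z : V)) h
        exact absurd y.2 (h' ▸ disjoint_ball_sphere x₀ n x.2)
      · have h' : (x : V) = y := congrArg (fun z : ball G x₀ (n + 1) => (z : V)) h
        exact absurd x.2 (h' ▸ disjoint_ball_sphere x₀ n y.2)
      · have h' : (x : V) = y := congrArg (fun z : ball G x₀ (n + 1) => (z : V)) h
        exact congrArg Sum.inr (Subtype.ext h')
    · rintro ⟨x, hx⟩
      by_cases h : x ∈ ball G x₀ n
      · exact ⟨Sum.inl ⟨x, h⟩, rfl⟩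
      · exact ⟨Sum.inr ⟨x, mem_ball_succ hx h⟩, rfl⟩

variable {G x₀}

@[simp] theorem coe_ballSuccEquiv_inl {n : ℕ} (x : ball G x₀ n) :
    (ballSuccEquiv G x₀ n (Sum.inl x) : V) = x := rfl

@[simp] theorem coe_ballSuccEquiv_inr {n : ℕ} (y : sphere G x₀ (n + 1)) :
    (ballSuccEquiv G x₀ n (Sum.inr y) : V) = y := rfl

/-- The configuration on `V_{n+1}` made of one on `V_n` and one on `W_{n+1}`. -/
def glue {n : ℕ} (x : (ball G x₀ n → unitInterval) × (sphere G x₀ (n + 1) → unitInterval)) :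
    ball G x₀ (n + 1) → unitInterval :=
  fun c => Sum.elim x.1 x.2 ((ballSuccEquiv G x₀ n).symm c)

@[simp] theorem glue_inl {n : ℕ}
    (x : (ball G x₀ n → unitInterval) × (sphere G x₀ (n + 1) → unitInterval)) (v : ball G x₀ n) :
    glue x (ballSuccEquiv G x₀ n (Sum.inl v)) = x.1 v := by
  simp [glue]

@[simp] theorem glue_inr {n : ℕ}
    (x : (ball G x₀ n → unitInterval) × (sphere G x₀ (n + 1) → unitInterval))
    (v : sphere G x₀ (n + 1)) :
    glue x (ballSuccEquiv G x₀ n (Sum.inr v)) = x.2 v := by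
  simp [glue]

theorem measurePreserving_glue [G.LocallyFinite] {n : ℕ} :
    MeasurePreserving (glue (G := G) (x₀ := x₀) (n := n)) (volume.prod volume) volume :=
  measurePreserving_sumElim volume (ballSuccEquiv G x₀ n)

/-- Restriction of configurations from `V_{n+1}` to `V_n`. -/
def ballRestrict (n : ℕ) (σ : ball G x₀ (n + 1) → unitInterval) : ball G x₀ n → unitInterval :=
  fun x => σ (ballSuccEquiv G x₀ n (Sum.inl x))

theorem measurable_ballRestrict (n : ℕ) : Measurable (ballRestrict (G := G) (x₀ := x₀) n) :=
  measurable_pi_lambda _ fun _ => measurable_pi_apply _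

theorem ballRestrict_glue {n : ℕ}
    (x : (ball G x₀ n → unitInterval) × (sphere G x₀ (n + 1) → unitInterval)) :
    ballRestrict n (glue x) = x.1 :=
  funext fun v => glue_inl x v

theorem map_domRestrict_eq (μ : Measure (Config V)) (n : ℕ) :
    μ.map (Set.domRestrict (ball G x₀ n)) =
      (μ.map (Set.domRestrict (ball G x₀ (n + 1)))).map (ballRestrict n) := by
  rw [Measure.map_map (measurable_ballRestrict n) (Set.measurable_restrict _)]
  rfl

end Glue

/-! ### Splitting measures satisfy the DLR equations -/

section SplittingGibbs

open Function Classical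

variable {V : Type*} {G : SimpleGraph V} [G.LocallyFinite] {K : unitInterval → unitInterval → ℝ}
  {x₀ : V}

theorem sum_ball_succ {n : ℕ} (f : ball G x₀ (n + 1) → ℝ) :
    ∑ x, f x = ∑ x : ball G x₀ n, f (ballSuccEquiv G x₀ n (Sum.inl x)) +
      ∑ y : sphere G x₀ (n + 1), f (ballSuccEquiv G x₀ n (Sum.inr y)) := by
  rw [← (ballSuccEquiv G x₀ n).sum_comp, Fintype.sum_sum_type]

theorem boundaryEnergy_congr {n : ℕ} (σ : ball G x₀ n → unitInterval) {ω ω' : Config V}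
    (h : ∀ y ∈ sphere G x₀ (n + 1), ω y = ω' y) :
    boundaryEnergy G K x₀ n σ ω = boundaryEnergy G K x₀ n σ ω' := by
  simp only [boundaryEnergy]
  congr 1
  refine Finset.sum_congr rfl fun x _ => Finset.sum_congr rfl fun y _ => ?_
  rw [h y y.2]

theorem gibbsDensity_congr {n : ℕ} (σ : ball G x₀ n → unitInterval) {ω ω' : Config V}
    (h : ∀ y ∈ sphere G x₀ (n + 1), ω y = ω' y) :
    gibbsDensity G K x₀ n ω σ = gibbsDensity G K x₀ n ω' σ := by
  simp only [gibbsDensity, boundaryEnergy_congr _ h]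

theorem IsSucc.notMem_ball {n : ℕ} {x y : V} (h : IsSucc G x₀ x y)
    (hx : x ∈ sphere G x₀ n) : y ∉ ball G x₀ n := by
  intro hy
  have h1 : G.edist x₀ x = (n : ℕ) := hx
  have h2 : G.edist x₀ y ≤ (n : ℕ) := hy
  rw [h.2, h1] at h2
  norm_cast at h2
  omega

/-- A configuration on `W_{n+1}`, extended by `0`. -/
def extendSphere {n : ℕ} (τ : sphere G x₀ n → unitInterval) : Config V :=
  fun x => if h : x ∈ sphere G x₀ n then τ ⟨x, h⟩ else 0

theorem extendSphere_apply {n : ℕ} (τ : sphere G x₀ n → unitInterval) (x : sphere G x₀ n) :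
    extendSphere τ x = τ x := by
  simp [extendSphere]

theorem measurable_extendSphere {n : ℕ} :
    Measurable (extendSphere : (sphere G x₀ n → unitInterval) → Config V) := by
  refine measurable_pi_lambda _ fun x => ?_
  simp only [extendSphere]
  split_ifs with h
  · exact measurable_pi_apply _
  · exact measurable_const

/-- No successor of a vertex of `W_{n+1}` lies in `V_{n+1}`, so the oriented edges of `V_{n+1}` all
start in `V_n`. -/
theorem energy_glue {n : ℕ} (σ : ball G x₀ n → unitInterval)
    (τ : sphere G x₀ (n + 1) → unitInterval) :
    energy G K x₀ (n + 1) (glue (σ, τ)) =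
      energy G K x₀ n σ + boundaryEnergy G K x₀ n σ (extendSphere τ) := by
  have h1 : ∀ (y : sphere G x₀ (n + 1)) (z : ball G x₀ (n + 1)), ¬ IsSucc G x₀ y z :=
    fun y z h => h.notMem_ball y.2 z.2
  simp only [energy, boundaryEnergy]
  rw [sum_ball_succ]
  simp only [sum_ball_succ, glue_inl, glue_inr, coe_ballSuccEquiv_inl, coe_ballSuccEquiv_inr,
    extendSphere_apply, Finset.sum_add_distrib]
  have h2 : ∀ (y : sphere G x₀ (n + 1)) (x : ball G x₀ n), ¬ IsSucc G x₀ y x := fun y x =>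
    h1 y (ballSuccEquiv G x₀ n (Sum.inl x))
  have h3 : ∀ y y' : sphere G x₀ (n + 1), ¬ IsSucc G x₀ y y' := fun y y' =>
    h1 y (ballSuccEquiv G x₀ n (Sum.inr y'))
  simp only [h2, h3, if_false, Finset.sum_const_zero]
  ring

/-- The boundary function enters only through a factor in `τ`, which cancels when conditioning on
the outer sphere. This is why a splitting measure is Gibbs whatever `h` is. -/
theorem splittingWeight_glue (h : V → unitInterval → ℝ) {n : ℕ} (σ : ball G x₀ n → unitInterval)
    (τ : sphere G x₀ (n + 1) → unitInterval) :
    splittingWeight G K x₀ h (n + 1) (glue (σ, τ)) =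
      Real.exp (-(energy G K x₀ n σ + boundaryEnergy G K x₀ n σ (extendSphere τ))) *
        Real.exp (∑ y : sphere G x₀ (n + 1), h y (τ y)) := by
  rw [← Real.exp_add, splittingWeight, energy_glue]
  congr 2
  have e1 : ∀ x : ball G x₀ n, (x : V) ∉ sphere G x₀ (n + 1) := fun x =>
    disjoint_ball_sphere x₀ n x.2
  rw [sum_ball_succ]
  simp [e1]

theorem ne_root_of_mem_sphere {n : ℕ} {x : V} (hx : x ∈ sphere G x₀ (n + 1)) : x ≠ x₀ := by
  rintro rfl
  have : G.edist x x = (n + 1 : ℕ) := hx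
  rw [SimpleGraph.edist_self] at this
  norm_cast at this

theorem measurable_splittingWeight
    (hKcont : Continuous (fun p : unitInterval × unitInterval => K p.1 p.2))
    (hKpos : ∀ t u, 0 < K t u) {h : V → unitInterval → ℝ} (hh : ∀ x, x ≠ x₀ → Measurable (h x))
    (n : ℕ) : Measurable (splittingWeight G K x₀ h (n + 1)) := by
  refine ((continuous_energy hKcont hKpos (n + 1)).measurable.neg.add
    (Finset.measurable_sum _ fun x _ => ?_)).exp
  split_ifs with hx
  · exact (hh x (ne_root_of_mem_sphere hx)).comp (measurable_pi_apply x)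
  · exact measurable_const

theorem splittingWeight_pos (h : V → unitInterval → ℝ) (n : ℕ)
    (σ : ball G x₀ n → unitInterval) : 0 < splittingWeight G K x₀ h n σ := Real.exp_pos _

/-- The restriction of the law `μ^{(n+1)}` to `V_n`. -/
theorem map_splittingLaw
    (hKcont : Continuous (fun p : unitInterval × unitInterval => K p.1 p.2))
    (hKpos : ∀ t u, 0 < K t u) {h : V → unitInterval → ℝ} (hh : ∀ x, x ≠ x₀ → Measurable (h x))
    (n : ℕ) :
    (splittingLaw G K x₀ h (n + 1)).map (ballRestrict n) = volume.withDensity fun σ =>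
      ∫⁻ τ : sphere G x₀ (n + 1) → unitInterval,
        ENNReal.ofReal (splittingWeight G K x₀ h (n + 1) (glue (σ, τ)) /
          ∫ c, splittingWeight G K x₀ h (n + 1) c) :=
  map_withDensity_of_measurePreserving measurePreserving_glue (measurable_ballRestrict n)
    ballRestrict_glue ((measurable_splittingWeight hKcont hKpos hh n).div_const _).ennreal_ofReal

/-- A splitting Gibbs measure is a Gibbs measure. -/
theorem IsSplitting.isGibbs
    (hKcont : Continuous (fun p : unitInterval × unitInterval => K p.1 p.2))
    (hKpos : ∀ t u, 0 < K t u) {ν : Measure (Config V)} [IsProbabilityMeasure ν]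
    (hν : IsSplitting G K x₀ ν) : IsGibbs G K x₀ ν := by
  obtain ⟨h, hh, hlaw⟩ := hν
  intro n hn
  have hhm : ∀ x, x ≠ x₀ → Measurable (h x) := fun x hx => (hh x hx).1
  rw [map_domRestrict_eq, hlaw (n + 1) (by omega), map_splittingLaw hKcont hKpos hhm]
  congr 1
  funext σ
  set Z := ∫ c, splittingWeight G K x₀ h (n + 1) c with hZ
  have hZ0 : 0 ≤ Z := integral_nonneg fun c => (splittingWeight_pos h _ c).le
  set w : (ball G x₀ n → unitInterval) → (sphere G x₀ (n + 1) → unitInterval) → ℝ := fun σ τ =>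
    Real.exp (-(energy G K x₀ n σ + boundaryEnergy G K x₀ n σ (extendSphere τ))) with hw
  set B : (sphere G x₀ (n + 1) → unitInterval) → ℝ := fun τ =>
    Real.exp (∑ y : sphere G x₀ (n + 1), h y (τ y)) / Z with hB
  have hB0 : ∀ τ, 0 ≤ B τ := fun τ => div_nonneg (Real.exp_pos _).le hZ0
  have hdens : ∀ σ τ, ENNReal.ofReal (splittingWeight G K x₀ h (n + 1) (glue (σ, τ)) / Z) =
      ENNReal.ofReal (w σ τ) * ENNReal.ofReal (B τ) := by
    intro σ τ
    rw [splittingWeight_glue, mul_div_assoc, ENNReal.ofReal_mul (Real.exp_pos _).le]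
  have hgdm : Measurable fun ω : Config V => ENNReal.ofReal (gibbsDensity G K x₀ n ω σ) :=
    ((measurable_gibbsDensity hKcont hKpos n).comp measurable_prodMk_right).ennreal_ofReal
  have hgd : ∀ ω : Config V, gibbsDensity G K x₀ n ω σ =
      gibbsDensity G K x₀ n (extend (Set.domRestrict (ball G x₀ (n + 1)) ω)) σ := fun ω =>
    gibbsDensity_congr σ fun y hy => (extend_domRestrict ω (sphere_subset_ball G x₀ _ hy)).symm
  have hDm : Measurable fun c => ENNReal.ofReal (splittingWeight G K x₀ h (n + 1) c / Z) :=
    ((measurable_splittingWeight hKcont hKpos hhm n).div_const _).ennreal_ofReal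
  have hge : Measurable fun c : ball G x₀ (n + 1) → unitInterval =>
      ENNReal.ofReal (gibbsDensity G K x₀ n (extend c) σ) := hgdm.comp measurable_extend
  have hDge : Measurable fun c : ball G x₀ (n + 1) → unitInterval =>
      ENNReal.ofReal (splittingWeight G K x₀ h (n + 1) c / Z) *
        ENNReal.ofReal (gibbsDensity G K x₀ n (extend c) σ) := hDm.mul hge
  have hext : ∀ x : (ball G x₀ n → unitInterval) × (sphere G x₀ (n + 1) → unitInterval),
      gibbsDensity G K x₀ n (extend (glue x)) σ =
        gibbsDensity G K x₀ n (extendSphere x.2) σ := by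
    rintro ⟨σ', τ⟩
    refine gibbsDensity_congr σ fun y hy => ?_
    have h1 := extend_apply (glue (σ', τ)) (ballSuccEquiv G x₀ n (Sum.inr ⟨y, hy⟩))
    have h2 := extendSphere_apply τ ⟨y, hy⟩
    rw [glue_inr] at h1
    exact h1.trans h2.symm
  symm
  calc ∫⁻ ω, ENNReal.ofReal (gibbsDensity G K x₀ n ω σ) ∂ν
      = ∫⁻ c, ENNReal.ofReal (gibbsDensity G K x₀ n (extend c) σ)
          ∂(splittingLaw G K x₀ h (n + 1)) := by
        rw [← hlaw (n + 1) (by omega), lintegral_map hge (Set.measurable_restrict _)]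
        exact lintegral_congr fun ω => by rw [← hgd]
    _ = ∫⁻ c, ENNReal.ofReal (splittingWeight G K x₀ h (n + 1) c / Z) *
          ENNReal.ofReal (gibbsDensity G K x₀ n (extend c) σ) := by
        rw [splittingLaw, lintegral_withDensity_eq_lintegral_mul _ hDm hge]
        rfl
    _ = ∫⁻ x : (ball G x₀ n → unitInterval) × (sphere G x₀ (n + 1) → unitInterval),
          ENNReal.ofReal (splittingWeight G K x₀ h (n + 1) (glue x) / Z) *
          ENNReal.ofReal (gibbsDensity G K x₀ n (extendSphere x.2) σ)
          ∂(volume.prod volume) := by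
        rw [← measurePreserving_glue.lintegral_comp hDge]
        exact lintegral_congr fun x => by rw [hext]
    _ = ∫⁻ τ : sphere G x₀ (n + 1) → unitInterval, ∫⁻ σ' : ball G x₀ n → unitInterval,
          ENNReal.ofReal (splittingWeight G K x₀ h (n + 1) (glue (σ', τ)) / Z) *
          ENNReal.ofReal (gibbsDensity G K x₀ n (extendSphere τ) σ) := by
        rw [lintegral_prod_symm']
        have h1 : Measurable fun τ : sphere G x₀ (n + 1) → unitInterval =>
            ENNReal.ofReal (gibbsDensity G K x₀ n (extendSphere τ) σ) :=
          hgdm.comp measurable_extendSphere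
        exact (hDm.comp measurePreserving_glue.measurable).mul (h1.comp measurable_snd)
    _ = _ := by
        -- For fixed `τ` the joint density is `w σ' τ * B τ` and the Gibbs density is `w σ τ / ∫ w`.
        -- Integrating out `σ'` cancels the denominator and returns the joint density at `(σ, τ)`.
        refine lintegral_congr fun τ => ?_
        have hUc : Continuous fun σ' : ball G x₀ n → unitInterval =>
            boundaryEnergy G K x₀ n σ' (extendSphere τ) :=
          (continuous_boundaryEnergy hKcont hKpos n).comp
            (Continuous.prodMk_right (extendSphere τ))
        have hwc : Continuous fun σ' => w σ' τ :=
          ((continuous_energy hKcont hKpos n).add hUc).neg.rexp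
        have hwi : Integrable fun σ' => w σ' τ := integrable_of_continuous hwc
        have hpos : 0 < ∫ σ', w σ' τ := integral_exp_pos hwi
        have h1 : ENNReal.ofReal (∫ σ', w σ' τ) = ∫⁻ σ', ENNReal.ofReal (w σ' τ) :=
          ofReal_integral_eq_lintegral_ofReal hwi (ae_of_all _ fun _ => (Real.exp_pos _).le)
        have h2 : gibbsDensity G K x₀ n (extendSphere τ) σ = w σ τ / ∫ σ', w σ' τ := by
          simp only [gibbsDensity, hw]
        have h3 : Measurable fun σ' => ENNReal.ofReal (w σ' τ) := hwc.measurable.ennreal_ofReal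
        simp only [hdens]
        rw [lintegral_mul_const _ (h3.mul_const _), lintegral_mul_const _ h3, ← h1, h2,
          ENNReal.ofReal_div_of_pos hpos, mul_right_comm,
          ENNReal.mul_div_cancel (ENNReal.ofReal_pos.2 hpos).ne' ENNReal.ofReal_ne_top]

end SplittingGibbs

/-! ### Hilbert's metric and the boundary equation -/

section FixedPoint

open Filter Topology

variable {K : unitInterval → unitInterval → ℝ}

variable (K) in
/-- The integral operator with kernel `K`, applied to `exp φ`. -/
def expOperator (φ : unitInterval → ℝ) (t : unitInterval) : ℝ := ∫ u, K t u * Real.exp (φ u)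

theorem integrable_mul_exp
    (hKcont : Continuous (fun p : unitInterval × unitInterval => K p.1 p.2))
    {φ : unitInterval → ℝ} (hφ : Measurable φ) {C : ℝ} (hC : ∀ t, |φ t| ≤ C) (t : unitInterval) :
    Integrable fun u => K t u * Real.exp (φ u) := by
  have h1 : Continuous fun u => K t u := hKcont.comp (Continuous.prodMk_right t)
  refine (integrable_of_continuous h1).mul_bdd (c := Real.exp C) hφ.exp.aestronglyMeasurable
    (ae_of_all _ fun u => ?_)
  rw [Real.norm_eq_abs, Real.abs_exp, Real.exp_le_exp]
  exact (le_abs_self _).trans (hC u)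

theorem integrable_exp_of_bounded {φ : unitInterval → ℝ} (hφ : Measurable φ) {C : ℝ}
    (hC : ∀ t, |φ t| ≤ C) : Integrable (fun u => Real.exp (φ u)) :=
  Integrable.of_bound hφ.exp.aestronglyMeasurable (Real.exp C) (ae_of_all _ fun u => by
    rw [Real.norm_eq_abs, Real.abs_exp, Real.exp_le_exp]
    exact (le_abs_self _).trans (hC u))

theorem expOperator_pos
    (hKcont : Continuous (fun p : unitInterval × unitInterval => K p.1 p.2)) {m : ℝ}
    (hm0 : 0 < m) (hm : ∀ t u, m ≤ K t u) {φ : unitInterval → ℝ} (hφ : Measurable φ) {C : ℝ}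
    (hC : ∀ t, |φ t| ≤ C) (t : unitInterval) : 0 < expOperator K φ t := by
  have h1 := integrable_exp_of_bounded hφ hC
  calc 0 < m * ∫ u, Real.exp (φ u) := mul_pos hm0 (integral_exp_pos h1)
    _ = ∫ u, m * Real.exp (φ u) := (integral_const_mul _ _).symm
    _ ≤ _ := integral_mono (h1.const_mul m) (integrable_mul_exp hKcont hφ hC t) fun u =>
        mul_le_mul_of_nonneg_right (hm t u) (Real.exp_pos _).le

theorem measurable_expOperator
    (hKcont : Continuous (fun p : unitInterval × unitInterval => K p.1 p.2))
    {φ : unitInterval → ℝ} (hφ : Measurable φ) : Measurable (expOperator K φ) := by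
  have h : Measurable fun p : unitInterval × unitInterval => K p.1 p.2 * Real.exp (φ p.2) :=
    hKcont.measurable.mul (hφ.comp measurable_snd).exp
  exact h.stronglyMeasurable.integral_prod_right'.measurable

/-- Any two rows of the kernel are comparable up to the factor `m / M`. This gives both the
contraction and the a priori bound on the iterates. -/
theorem mul_integral_mul_le
    (hKcont : Continuous (fun p : unitInterval × unitInterval => K p.1 p.2)) {m M : ℝ}
    (hm0 : 0 < m) (hm : ∀ t u, m ≤ K t u) (hM : ∀ t u, K t u ≤ M) {f : unitInterval → ℝ}
    (hf : ∀ t, Integrable fun u => K t u * f u) (hf0 : ∀ u, 0 ≤ f u) (s t : unitInterval) :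
    m / M * ∫ u, K s u * f u ≤ ∫ u, K t u * f u := by
  rw [← integral_const_mul]
  have hM0 : 0 < M := hm0.trans_le ((hm 0 0).trans (hM 0 0))
  refine integral_mono ((hf s).const_mul _) (hf t) fun u => ?_
  have h1 : m / M * K s u ≤ K t u := by
    calc m / M * K s u ≤ m / M * M := mul_le_mul_of_nonneg_left (hM s u) (div_pos hm0 hM0).le
      _ = m := div_mul_cancel₀ m hM0.ne'
      _ ≤ _ := hm t u
  calc m / M * (K s u * f u) = (m / M * K s u) * f u := by ring
    _ ≤ _ := mul_le_mul_of_nonneg_right h1 (hf0 u)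

/-- The integral operator with kernel `K` contracts Hilbert's projective metric. -/
theorem log_expOperator_sub_le
    (hKcont : Continuous (fun p : unitInterval × unitInterval => K p.1 p.2)) {m M : ℝ}
    (hm0 : 0 < m) (hm : ∀ t u, m ≤ K t u) (hM : ∀ t u, K t u ≤ M) {φ ψ : unitInterval → ℝ}
    (hφ : Measurable φ) (hψ : Measurable ψ) {C : ℝ} (hφC : ∀ t, |φ t| ≤ C) (hψC : ∀ t, |ψ t| ≤ C)
    {δ : ℝ} (hδ : ∀ s t, (φ s - ψ s) - (φ t - ψ t) ≤ δ) (s t : unitInterval) :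
    (Real.log (expOperator K φ s) - Real.log (expOperator K ψ s)) -
      (Real.log (expOperator K φ t) - Real.log (expOperator K ψ t)) ≤ (1 - (m / M) ^ 2) * δ := by
  have hM0 : 0 < M := hm0.trans_le ((hm 0 0).trans (hM 0 0))
  have hq0 : 0 < m / M := div_pos hm0 hM0
  have hq1 : m / M ≤ 1 := (div_le_one hM0).2 ((hm 0 0).trans (hM 0 0))
  have hδ0 : 0 ≤ δ := by simpa using hδ s s
  have hFi := integrable_mul_exp hKcont hφ hφC
  have hGi := integrable_mul_exp hKcont hψ hψC
  have hF := expOperator_pos hKcont hm0 hm hφ hφC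
  have hG := expOperator_pos hKcont hm0 hm hψ hψC
  set F := expOperator K φ with hFdef
  set H := expOperator K ψ with hHdef
  set X := F s / H s with hX
  have hX0 : 0 < X := div_pos (hF s) (hG s)
  -- `X` is a weighted mean of `exp (φ - ψ)`, whose logarithm oscillates by at most `δ`. Hence `a`
  -- bounds that ratio below everywhere, and `exp φ - a * exp ψ` is a nonnegative function to which
  -- the row comparison applies.
  set a := Real.exp (-δ) * X with ha
  have hafg : ∀ u, a * Real.exp (ψ u) ≤ Real.exp (φ u) := by
    intro u
    have h1 : F s ≤ Real.exp (δ + φ u - ψ u) * H s := by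
      rw [hHdef, expOperator, ← integral_const_mul]
      refine integral_mono (hFi s) ((hGi s).const_mul _) fun v => ?_
      have h2 : Real.exp (φ v) ≤ Real.exp (δ + φ u - ψ u) * Real.exp (ψ v) := by
        rw [← Real.exp_add, Real.exp_le_exp]; linarith [hδ v u]
      calc K s v * Real.exp (φ v)
          ≤ K s v * (Real.exp (δ + φ u - ψ u) * Real.exp (ψ v)) :=
            mul_le_mul_of_nonneg_left h2 (hm0.trans_le (hm s v)).le
        _ = _ := by ring
    have h3 : X ≤ Real.exp (δ + φ u - ψ u) := (div_le_iff₀ (hG s)).2 h1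
    calc a * Real.exp (ψ u) ≤ Real.exp (-δ) * Real.exp (δ + φ u - ψ u) * Real.exp (ψ u) := by
          rw [ha]; gcongr
      _ = Real.exp (φ u) := by rw [← Real.exp_add, ← Real.exp_add]; ring_nf
  have hdi : ∀ t, Integrable fun u => K t u * (Real.exp (φ u) - a * Real.exp (ψ u)) := by
    intro t
    have := (hFi t).sub ((hGi t).const_mul a)
    refine this.congr (ae_of_all _ fun u => ?_)
    simp only [Pi.sub_apply]; ring
  have hd : ∀ t, ∫ u, K t u * (Real.exp (φ u) - a * Real.exp (ψ u)) = F t - a * H t := by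
    intro t
    rw [hFdef, hHdef, expOperator, expOperator, ← integral_const_mul,
      ← integral_sub (hFi t) ((hGi t).const_mul a)]
    exact integral_congr_ae (ae_of_all _ fun u => by ring)
  have h1 : m / M * (F s - a * H s) ≤ F t - a * H t := by
    rw [← hd, ← hd]
    exact mul_integral_mul_le hKcont hm0 hm hM hdi (fun u => sub_nonneg.2 (hafg u)) s t
  have h2 : m / M * H t ≤ H s :=
    mul_integral_mul_le hKcont hm0 hm hM hGi (fun u => (Real.exp_pos _).le) t s
  have hFs : F s = X * H s := (div_mul_cancel₀ _ (hG s).ne').symm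
  have he1 : Real.exp (-δ) ≤ 1 := Real.exp_le_one_iff.2 (by linarith)
  have hXa : 0 ≤ X - a := by
    rw [ha]; nlinarith
  -- Write `F t = (F t - a * H t) + a * H t`. The bracket is at least `m / M * (X - a) * H s`, and
  -- `H s ≥ m / M * H t`.
  have h3 : X * ((m / M) ^ 2 + (1 - (m / M) ^ 2) * Real.exp (-δ)) ≤ F t / H t := by
    rw [le_div_iff₀ (hG t)]
    have h4 : m / M * (m / M * H t * (X - a)) ≤ m / M * (F s - a * H s) := by
      rw [hFs]
      refine mul_le_mul_of_nonneg_left ?_ hq0.le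
      calc m / M * H t * (X - a) ≤ H s * (X - a) := mul_le_mul_of_nonneg_right h2 hXa
        _ = _ := by ring
    have h5 := h4.trans h1
    have h6 : X * ((m / M) ^ 2 + (1 - (m / M) ^ 2) * Real.exp (-δ)) * H t =
        m / M * (m / M * H t * (X - a)) + a * H t := by rw [ha]; ring
    linarith
  -- Convexity of `exp` at the points `0` and `-δ` turns the mixture into a linear rate in `δ`.
  have hconv : Real.exp (-((1 - (m / M) ^ 2) * δ)) ≤
      (m / M) ^ 2 + (1 - (m / M) ^ 2) * Real.exp (-δ) := by
    have hk1 : (m / M) ^ 2 ≤ 1 := pow_le_one₀ hq0.le hq1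
    have := convexOn_exp.2 (Set.mem_univ 0) (Set.mem_univ (-δ)) (by positivity : 0 ≤ (m / M) ^ 2)
      (by linarith : 0 ≤ 1 - (m / M) ^ 2) (by ring)
    simp only [smul_eq_mul, mul_zero, zero_add, Real.exp_zero, mul_one] at this
    rwa [mul_neg] at this
  have h7 : X * Real.exp (-((1 - (m / M) ^ 2) * δ)) ≤ F t / H t :=
    (mul_le_mul_of_nonneg_left hconv hX0.le).trans h3
  have h8 := Real.log_le_log (mul_pos hX0 (Real.exp_pos _)) h7
  rw [Real.log_mul hX0.ne' (Real.exp_pos _).ne', Real.log_exp, hX,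
    Real.log_div (hF s).ne' (hG s).ne', Real.log_div (hF t).ne' (hG t).ne'] at h8
  linarith

theorem abs_log_expOperator_sub_le
    (hKcont : Continuous (fun p : unitInterval × unitInterval => K p.1 p.2)) {m M : ℝ}
    (hm0 : 0 < m) (hm : ∀ t u, m ≤ K t u) (hM : ∀ t u, K t u ≤ M) {φ : unitInterval → ℝ}
    (hφ : Measurable φ) {C : ℝ} (hφC : ∀ t, |φ t| ≤ C) (s t : unitInterval) :
    |Real.log (expOperator K φ s) - Real.log (expOperator K φ t)| ≤ -Real.log (m / M) := by
  have hM0 : 0 < M := hm0.trans_le ((hm 0 0).trans (hM 0 0))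
  have hq0 : 0 < m / M := div_pos hm0 hM0
  have hF := expOperator_pos hKcont hm0 hm hφ hφC
  have key : ∀ s t, Real.log (m / M) + Real.log (expOperator K φ s) ≤
      Real.log (expOperator K φ t) := fun s t => by
    rw [← Real.log_mul hq0.ne' (hF s).ne']
    exact Real.log_le_log (mul_pos hq0 (hF s)) (mul_integral_mul_le hKcont hm0 hm hM
      (integrable_mul_exp hKcont hφ hφC) (fun u => (Real.exp_pos _).le) s t)
  exact abs_le.2 ⟨by linarith [key t s], by linarith [key s t]⟩

variable (K) in
/-- The (logarithm of the) boundary law iteration, normalized at `0`. -/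
def boundaryStep (k : ℕ) (φ : unitInterval → ℝ) (t : unitInterval) : ℝ :=
  k * (Real.log (expOperator K φ t) - Real.log (expOperator K φ 0))

/-- The equation for translation-invariant boundary functions has a bounded solution. -/
theorem exists_boundaryStep_fixedPoint
    (hKcont : Continuous (fun p : unitInterval × unitInterval => K p.1 p.2)) {m M : ℝ}
    (hm0 : 0 < m) (hm : ∀ t u, m ≤ K t u) (hM : ∀ t u, K t u ≤ M) {k : ℕ}
    (hk : k * (1 - (m / M) ^ 2) < 1) :
    ∃ φ : unitInterval → ℝ, Measurable φ ∧ (∃ C : ℝ, ∀ t, |φ t| ≤ C) ∧ boundaryStep K k φ = φ := by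
  have hM0 : 0 < M := hm0.trans_le ((hm 0 0).trans (hM 0 0))
  have hq0 : 0 < m / M := div_pos hm0 hM0
  have hq1 : m / M ≤ 1 := (div_le_one hM0).2 ((hm 0 0).trans (hM 0 0))
  set β : ℝ := k * (1 - (m / M) ^ 2) with hβ
  have hβ0 : 0 ≤ β := mul_nonneg (Nat.cast_nonneg k)
    (by have := pow_le_one₀ hq0.le hq1 (n := 2); linarith)
  set C : ℝ := k * -Real.log (m / M) with hC
  have hC0 : 0 ≤ C := mul_nonneg (Nat.cast_nonneg k)
    (by have := Real.log_nonpos hq0.le hq1; linarith)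
  set Φ : ℕ → unitInterval → ℝ := fun n => (boundaryStep K k)^[n] fun _ => 0 with hΦ
  have hΦs : ∀ n, Φ (n + 1) = boundaryStep K k (Φ n) := fun n => by
    simp only [hΦ, Function.iterate_succ_apply']
  have hΦm : ∀ n, Measurable (Φ n) ∧ ∀ t, |Φ n t| ≤ C := by
    intro n
    induction n with
    | zero => exact ⟨measurable_const, fun t => by simpa [hΦ] using hC0⟩
    | succ n ih =>
      rw [hΦs]
      refine ⟨(((measurable_expOperator hKcont ih.1).log).sub_const _).const_mul _, fun t => ?_⟩
      rw [boundaryStep, abs_mul, Nat.abs_cast]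
      exact mul_le_mul_of_nonneg_left
        (abs_log_expOperator_sub_le hKcont hm0 hm hM ih.1 ih.2 t 0) (Nat.cast_nonneg k)
  -- The contraction only controls oscillations; the normalization at `0` converts it into a bound
  -- on values.
  have hΦ0 : ∀ n, Φ n 0 = 0 := by
    intro n
    cases n with
    | zero => rfl
    | succ n => rw [hΦs, boundaryStep, sub_self, mul_zero]
  -- The initial constant `4 * C` bounds four terms, each of size at most `C`.
  have hosc : ∀ n s t, (Φ (n + 1) s - Φ n s) - (Φ (n + 1) t - Φ n t) ≤ β ^ n * (4 * C) := by
    intro n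
    induction n with
    | zero =>
      intro s t
      have h1 := abs_le.1 ((hΦm 1).2 s)
      have h2 := abs_le.1 ((hΦm 0).2 s)
      have h3 := abs_le.1 ((hΦm 1).2 t)
      have h4 := abs_le.1 ((hΦm 0).2 t)
      rw [pow_zero, one_mul, zero_add]
      linarith
    | succ n ih =>
      intro s t
      have h1 := log_expOperator_sub_le hKcont hm0 hm hM (hΦm (n + 1)).1 (hΦm n).1 (hΦm (n + 1)).2
        (hΦm n).2 ih s t
      have h2 := mul_le_mul_of_nonneg_left h1 (Nat.cast_nonneg (α := ℝ) k)
      have h3 : (Φ (n + 1 + 1) s - Φ (n + 1) s) - (Φ (n + 1 + 1) t - Φ (n + 1) t) =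
          k * ((Real.log (expOperator K (Φ (n + 1)) s) - Real.log (expOperator K (Φ n) s)) -
            (Real.log (expOperator K (Φ (n + 1)) t) - Real.log (expOperator K (Φ n) t))) := by
        rw [hΦs (n + 1)]
        nth_rewrite 2 [hΦs n]
        nth_rewrite 3 [hΦs n]
        simp only [boundaryStep]
        ring
      rw [h3]
      refine h2.trans (le_of_eq ?_)
      rw [hβ, pow_succ]; ring
  have hdist : ∀ t n, dist (Φ n t) (Φ (n + 1) t) ≤ 4 * C * β ^ n := by
    intro t n
    have h1 := hosc n t 0
    have h2 := hosc n 0 t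
    rw [hΦ0, hΦ0] at h1 h2
    rw [dist_comm, Real.dist_eq]
    exact abs_le.2 ⟨by linarith, by linarith⟩
  have hlim : ∀ t, ∃ y, Tendsto (fun n => Φ n t) atTop (𝓝 y) := fun t =>
    cauchySeq_tendsto_of_complete (cauchySeq_of_le_geometric β (4 * C) hk (hdist t))
  choose φ hφ using hlim
  have hφm : Measurable φ :=
    measurable_of_tendsto_metrizable (fun n => (hΦm n).1) (tendsto_pi_nhds.2 hφ)
  have hφC : ∀ t, |φ t| ≤ C := fun t => le_of_tendsto' (hφ t).abs fun n => (hΦm n).2 t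
  refine ⟨φ, hφm, ⟨C, hφC⟩, ?_⟩
  -- Pointwise limits suffice: the bound `C` common to all iterates permits dominated convergence.
  have hop : ∀ t, Tendsto (fun n => expOperator K (Φ n) t) atTop (𝓝 (expOperator K φ t)) := by
    intro t
    refine tendsto_integral_of_dominated_convergence (fun _ => M * Real.exp C)
      (fun n => (integrable_mul_exp hKcont (hΦm n).1 (hΦm n).2 t).aestronglyMeasurable)
      (integrable_const _) (fun n => ae_of_all _ fun u => ?_) (ae_of_all _ fun u => ?_)
    · rw [Real.norm_eq_abs, abs_mul, Real.abs_exp, abs_of_pos (hm0.trans_le (hm t u))]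
      refine mul_le_mul (hM t u) (Real.exp_le_exp.2 ?_) (Real.exp_pos _).le hM0.le
      exact (le_abs_self _).trans ((hΦm n).2 u)
    · exact ((Real.continuous_exp.tendsto _).comp (hφ u)).const_mul _
  have hpos := expOperator_pos hKcont hm0 hm hφm hφC
  funext t
  have h1 : Tendsto (fun n => Φ (n + 1) t) atTop (𝓝 (boundaryStep K k φ t)) := by
    simp only [hΦs, boundaryStep]
    exact (((hop t).log (hpos t).ne').sub ((hop 0).log (hpos 0).ne')).const_mul _
  exact tendsto_nhds_unique h1 ((tendsto_add_atTop_iff_nat 1).2 (hφ t))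

end FixedPoint

/-! ### Parents and successors in a regular tree -/

section TreeCounting

variable {V : Type*} {G : SimpleGraph V}

theorem isSucc_dist (hG : G.Connected) {x₀ x y : V} (h : IsSucc G x₀ x y) :
    G.dist x₀ y = G.dist x₀ x + 1 := by
  have h1 := h.2
  rw [← (hG x₀ x).coe_dist_eq_edist, ← (hG x₀ y).coe_dist_eq_edist] at h1
  exact_mod_cast h1

/-- Geodesics to two parents extend to two paths from the root to `y`; these coincide in a tree, and
so do their penultimate vertices. -/
theorem eq_of_isSucc (hG : G.IsTree) {x₀ x x' y : V} (h : IsSucc G x₀ x y)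
    (h' : IsSucc G x₀ x' y) : x = x' := by
  have hc := hG.connected
  obtain ⟨p, hp⟩ := hc.exists_walk_length_eq_dist x₀ x
  obtain ⟨p', hp'⟩ := hc.exists_walk_length_eq_dist x₀ x'
  have h1 : (p.concat h.1).IsPath := SimpleGraph.Walk.isPath_of_length_eq_dist _ (by
    rw [SimpleGraph.Walk.length_concat, hp, isSucc_dist hc h])
  have h2 : (p'.concat h'.1).IsPath := SimpleGraph.Walk.isPath_of_length_eq_dist _ (by
    rw [SimpleGraph.Walk.length_concat, hp', isSucc_dist hc h'])
  have h3 := (hG.existsUnique_path x₀ y).unique h1 h2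
  have h4 := congrArg SimpleGraph.Walk.penultimate h3
  simpa using h4

theorem exists_isSucc (hG : G.IsTree) {x₀ y : V} (hy : y ≠ x₀) : ∃ x, IsSucc G x₀ x y := by
  have hc := hG.connected
  obtain ⟨p, hp⟩ := hc.exists_walk_length_eq_dist x₀ y
  have hnil : ¬ p.Nil := fun h => hy h.eq.symm
  have hadj := p.adj_penultimate hnil
  refine ⟨p.penultimate, (isSucc_or_isSucc hG x₀ hadj).resolve_right fun h => ?_⟩
  have h1 := isSucc_dist hc h
  have h2 : G.dist x₀ p.penultimate ≤ p.dropLast.length := SimpleGraph.dist_le p.dropLast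
  have h3 := p.length_dropLast_add_one hnil
  omega

open Classical in
/-- In a tree, every neighbour of a vertex other than the root, except one, is a successor. -/
theorem card_filter_isSucc [G.LocallyFinite] (hG : G.IsTree) {k : ℕ}
    (hdeg : G.IsRegularOfDegree (k + 1)) {x₀ x : V} (hx : x ≠ x₀) :
    ((G.neighborFinset x).filter fun y => IsSucc G x₀ x y).card = k := by
  have hc := hG.connected
  obtain ⟨z, hz⟩ := exists_isSucc hG hx
  have h1 : (G.neighborFinset x).filter (fun y => ¬ IsSucc G x₀ x y) = {z} := by
    ext y
    simp only [Finset.mem_filter, SimpleGraph.mem_neighborFinset, Finset.mem_singleton]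
    constructor
    · rintro ⟨hadj, hns⟩
      exact eq_of_isSucc hG ((isSucc_or_isSucc hG x₀ hadj).resolve_left hns) hz
    · rintro rfl
      exact ⟨hz.1.symm, hz.not_symm hc⟩
  have h2 := Finset.card_filter_add_card_filter_not (s := G.neighborFinset x)
    (fun y => IsSucc G x₀ x y)
  rw [h1, Finset.card_singleton, SimpleGraph.card_neighborFinset_eq_degree, hdeg x] at h2
  omega

theorem IsSucc.mem_sphere {x₀ x y : V} {n : ℕ} (h : IsSucc G x₀ x y) :
    y ∈ sphere G x₀ (n + 1) ↔ x ∈ sphere G x₀ n := by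
  change G.edist x₀ y = (n + 1 : ℕ) ↔ G.edist x₀ x = n
  rw [h.2]
  push_cast
  exact WithTop.add_right_inj ENat.one_ne_top

/-- Countability makes the product σ-algebra on `[0,1]^V` the Borel one, as the weak topology on
measures requires. -/
theorem countable_of_locallyFinite [G.LocallyFinite] (hG : G.Connected) (x₀ : V) : Countable V := by
  have h : (⋃ n : ℕ, ball G x₀ n) = Set.univ := by
    refine Set.eq_univ_of_forall fun x => Set.mem_iUnion.2 ?_
    obtain ⟨n, -, hn⟩ := exists_subset_ball hG x₀ {x}
    exact ⟨n, hn (by simp)⟩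
  rw [← Set.countable_univ_iff, ← h]
  exact Set.countable_iUnion fun n => (ball_finite G x₀ n).countable

end TreeCounting

/-! ### Consistency of the finite-volume laws -/

section Consistency

open Classical

variable {V : Type*} {G : SimpleGraph V} [G.LocallyFinite] {K : unitInterval → unitInterval → ℝ}
  {x₀ : V}

theorem sum_isSucc_sphere (hG : G.IsTree) {k : ℕ} (hdeg : G.IsRegularOfDegree (k + 1)) {n : ℕ}
    (hn : 1 ≤ n) (x : ball G x₀ n) (a : ℝ) :
    ∑ y : sphere G x₀ (n + 1), (if IsSucc G x₀ x y then a else 0) =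
      if (x : V) ∈ sphere G x₀ n then k * a else 0 := by
  split_ifs with hx
  -- A positive radius excludes the root, which has `k + 1` successors instead of `k`.
  · obtain ⟨n, rfl⟩ := Nat.exists_eq_add_of_le' hn
    rw [Finset.sum_set_coe (sphere G x₀ (n + 1 + 1)) (f := fun y => if IsSucc G x₀ x y then a else 0),
      ← Finset.sum_filter, Finset.sum_const, nsmul_eq_mul,
      ← card_filter_isSucc hG hdeg (ne_root_of_mem_sphere hx)]
    congr 3
    ext y
    simp only [Finset.mem_filter, Set.mem_toFinset, SimpleGraph.mem_neighborFinset]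
    exact ⟨fun h => ⟨h.2.1, h.2⟩, fun h => ⟨h.2.mem_sphere.2 hx, h.2⟩⟩
  · exact Finset.sum_eq_zero fun y _ => if_neg fun h => hx (h.mem_sphere.1 y.2)

theorem exists_forall_isSucc_iff (hG : G.IsTree) {n : ℕ} (y : sphere G x₀ (n + 1)) :
    ∃ z : ball G x₀ n, ∀ x : ball G x₀ n, IsSucc G x₀ x y ↔ x = z := by
  obtain ⟨z, hz⟩ := exists_isSucc hG (ne_root_of_mem_sphere y.2)
  refine ⟨⟨z, sphere_subset_ball G x₀ n (hz.mem_sphere.1 y.2)⟩, fun x => ⟨fun h => ?_, ?_⟩⟩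
  · exact Subtype.ext (eq_of_isSucc hG h hz)
  · rintro rfl; exact hz

theorem integrable_splittingWeight
    (hKcont : Continuous (fun p : unitInterval × unitInterval => K p.1 p.2))
    (hKpos : ∀ t u, 0 < K t u) {φ : unitInterval → ℝ} (hφ : Measurable φ) {C : ℝ}
    (hC : ∀ t, |φ t| ≤ C) (n : ℕ) : Integrable (splittingWeight G K x₀ (fun _ => φ) n) := by
  have h1 : Integrable fun σ : ball G x₀ n → unitInterval => Real.exp (-energy G K x₀ n σ) :=
    integrable_of_continuous (continuous_energy hKcont hKpos n).neg.rexp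
  have h2 : Measurable fun σ : ball G x₀ n → unitInterval =>
      ∑ x : ball G x₀ n, if (x : V) ∈ sphere G x₀ n then φ (σ x) else 0 := by
    refine Finset.measurable_sum _ fun x _ => ?_
    split_ifs
    · exact hφ.comp (measurable_pi_apply x)
    · exact measurable_const
  have h3 := h1.mul_bdd (c := Real.exp (∑ _x : ball G x₀ n, C)) h2.exp.aestronglyMeasurable
    (ae_of_all _ fun σ => by
      rw [Real.norm_eq_abs, Real.abs_exp, Real.exp_le_exp]
      refine Finset.sum_le_sum fun x _ => ?_
      split_ifs
      · exact (le_abs_self _).trans (hC _)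
      · exact (abs_nonneg _).trans (hC 0))
  refine h3.congr (ae_of_all _ fun σ => ?_)
  simp only [splittingWeight, Real.exp_add]

theorem integral_splittingWeight_pos
    (hKcont : Continuous (fun p : unitInterval × unitInterval => K p.1 p.2))
    (hKpos : ∀ t u, 0 < K t u) {φ : unitInterval → ℝ} (hφ : Measurable φ) {C : ℝ}
    (hC : ∀ t, |φ t| ≤ C) (n : ℕ) : 0 < ∫ σ, splittingWeight G K x₀ (fun _ => φ) n σ :=
  integral_exp_pos (integrable_splittingWeight hKcont hKpos hφ hC n)

theorem isProbabilityMeasure_splittingLaw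
    (hKcont : Continuous (fun p : unitInterval × unitInterval => K p.1 p.2))
    (hKpos : ∀ t u, 0 < K t u) {φ : unitInterval → ℝ} (hφ : Measurable φ) {C : ℝ}
    (hC : ∀ t, |φ t| ≤ C) (n : ℕ) :
    IsProbabilityMeasure (splittingLaw G K x₀ (fun _ => φ) n) := by
  have hi := integrable_splittingWeight (G := G) (x₀ := x₀) hKcont hKpos hφ hC n
  have hpos := integral_splittingWeight_pos (G := G) (x₀ := x₀) hKcont hKpos hφ hC n
  constructor
  rw [splittingLaw, withDensity_apply _ MeasurableSet.univ, Measure.restrict_univ,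
    ← ofReal_integral_eq_lintegral_ofReal (hi.div_const _)
      (ae_of_all _ fun σ => div_nonneg (splittingWeight_pos _ _ _).le hpos.le),
    integral_div, div_self hpos.ne', ENNReal.ofReal_one]

/-- The weight of the spin `u` at a vertex of the outer sphere, given the configuration inside. -/
theorem integral_exp_sum_isSucc
    (hKcont : Continuous (fun p : unitInterval × unitInterval => K p.1 p.2)) {m : ℝ}
    (hm0 : 0 < m) (hm : ∀ t u, m ≤ K t u) {φ : unitInterval → ℝ} (hφ : Measurable φ) {C : ℝ}
    (hC : ∀ t, |φ t| ≤ C) (hG : G.IsTree) {n : ℕ} (σ : ball G x₀ n → unitInterval)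
    (y : sphere G x₀ (n + 1)) :
    ∫ u, Real.exp ((∑ x : ball G x₀ n, if IsSucc G x₀ x y then Real.log (K (σ x) u) else 0) + φ u) =
      Real.exp (∑ x : ball G x₀ n,
        if IsSucc G x₀ x y then Real.log (expOperator K φ (σ x)) else 0) := by
  obtain ⟨z, hz⟩ := exists_forall_isSucc_iff hG y
  simp only [hz, Finset.sum_ite_eq', Finset.mem_univ, if_true]
  rw [Real.exp_log (expOperator_pos hKcont hm0 hm hφ hC _), expOperator]
  refine integral_congr_ae (ae_of_all _ fun u => ?_)
  simp only [Real.exp_add, Real.exp_log (hm0.trans_le (hm (σ z) u))]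

/-- Given the spins in `V_n`, the weight is a product over `W_{n+1}`, so the outer spins can be
integrated out one by one. -/
theorem splittingWeight_glue_eq_prod (φ : unitInterval → ℝ) {n : ℕ}
    (σ : ball G x₀ n → unitInterval) (τ : sphere G x₀ (n + 1) → unitInterval) :
    splittingWeight G K x₀ (fun _ => φ) (n + 1) (glue (σ, τ)) = Real.exp (-energy G K x₀ n σ) *
      ∏ y : sphere G x₀ (n + 1), Real.exp ((∑ x : ball G x₀ n,
        if IsSucc G x₀ x y then Real.log (K (σ x) (τ y)) else 0) + φ (τ y)) := by
  rw [splittingWeight_glue, ← Real.exp_sum, ← Real.exp_add, ← Real.exp_add,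
    Finset.sum_add_distrib, boundaryEnergy, Finset.sum_comm]
  simp only [extendSphere_apply]
  congr 1
  ring

/-- Integrating out the outer sphere reproduces the weight on the smaller ball. -/
theorem integral_splittingWeight_glue
    (hKcont : Continuous (fun p : unitInterval × unitInterval => K p.1 p.2)) {m : ℝ}
    (hm0 : 0 < m) (hm : ∀ t u, m ≤ K t u) {φ : unitInterval → ℝ} (hφ : Measurable φ) {C : ℝ}
    (hC : ∀ t, |φ t| ≤ C) (hG : G.IsTree) {k : ℕ} (hdeg : G.IsRegularOfDegree (k + 1))
    (hfix : boundaryStep K k φ = φ) {n : ℕ} (hn : 1 ≤ n) (σ : ball G x₀ n → unitInterval) :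
    ∫ τ : sphere G x₀ (n + 1) → unitInterval,
        splittingWeight G K x₀ (fun _ => φ) (n + 1) (glue (σ, τ)) =
      splittingWeight G K x₀ (fun _ => φ) n σ *
        Real.exp (∑ x : ball G x₀ n, if (x : V) ∈ sphere G x₀ n then
          k * Real.log (expOperator K φ 0) else 0) := by
  simp only [splittingWeight_glue_eq_prod]
  rw [integral_const_mul, volume_pi, integral_fintype_prod_eq_prod
    (f := fun (y : sphere G x₀ (n + 1)) (u : unitInterval) => Real.exp ((∑ x : ball G x₀ n,
        if IsSucc G x₀ x y then Real.log (K (σ x) u) else 0) + φ u))]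
  simp only [integral_exp_sum_isSucc hKcont hm0 hm hφ hC hG]
  rw [← Real.exp_sum, ← Real.exp_add, splittingWeight, ← Real.exp_add, Finset.sum_comm, add_assoc,
    ← Finset.sum_add_distrib]
  congr 2
  -- With the sum regrouped by parents, each `x` in `W_n` contributes `k * log (expOperator K φ (σ
  -- x))`, which the fixed-point equation turns into `φ (σ x)` plus a constant.
  refine Finset.sum_congr rfl fun x _ => ?_
  rw [sum_isSucc_sphere hG hdeg hn]
  split_ifs
  · have h1 := congrFun hfix (σ x)
    rw [boundaryStep] at h1
    linarith
  · simp

/-- The laws `μ^{(n)}`, `n ≥ 1`, of a translation-invariant boundary function solving the boundary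
equation are consistent. -/
theorem map_splittingLaw_eq
    (hKcont : Continuous (fun p : unitInterval × unitInterval => K p.1 p.2)) {m : ℝ}
    (hm0 : 0 < m) (hm : ∀ t u, m ≤ K t u) {φ : unitInterval → ℝ} (hφ : Measurable φ) {C : ℝ}
    (hC : ∀ t, |φ t| ≤ C) (hG : G.IsTree) {k : ℕ} (hdeg : G.IsRegularOfDegree (k + 1))
    (hfix : boundaryStep K k φ = φ) {n : ℕ} (hn : 1 ≤ n) :
    (splittingLaw G K x₀ (fun _ => φ) (n + 1)).map (ballRestrict n) =
      splittingLaw G K x₀ (fun _ => φ) n := by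
  have hKpos : ∀ t u, 0 < K t u := fun t u => hm0.trans_le (hm t u)
  have hpos := integral_splittingWeight_pos (G := G) (x₀ := x₀) hKcont hKpos hφ hC
  have hpn := isProbabilityMeasure_splittingLaw (G := G) (x₀ := x₀) hKcont hKpos hφ hC (n + 1)
  set Z := ∫ σ, splittingWeight G K x₀ (fun _ => φ) n σ with hZ
  set Z' := ∫ σ, splittingWeight G K x₀ (fun _ => φ) (n + 1) σ with hZ'
  set a : ℝ := Real.exp (∑ x : ball G x₀ n, if (x : V) ∈ sphere G x₀ n then
          k * Real.log (expOperator K φ 0) else 0) / Z' with ha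
  have ha0 : 0 < a := div_pos (Real.exp_pos _) (hpos (n + 1))
  have h1 : (splittingLaw G K x₀ (fun _ => φ) (n + 1)).map (ballRestrict n) =
      volume.withDensity fun σ =>
        ENNReal.ofReal (splittingWeight G K x₀ (fun _ => φ) n σ * a) := by
    rw [map_splittingLaw hKcont hKpos fun _ _ => hφ]
    congr 1
    funext σ
    have hint := integral_splittingWeight_glue hKcont hm0 hm hφ hC hG hdeg hfix hn σ
    have hi : Integrable fun τ : sphere G x₀ (n + 1) → unitInterval =>
        splittingWeight G K x₀ (fun _ => φ) (n + 1) (glue (σ, τ)) := by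
      by_contra h
      rw [integral_undef h] at hint
      exact (mul_pos (splittingWeight_pos _ _ _) (Real.exp_pos _)).ne hint
    rw [← ofReal_integral_eq_lintegral_ofReal (hi.div_const _)
      (ae_of_all _ fun τ => div_nonneg (splittingWeight_pos _ _ _).le (hpos (n + 1)).le),
      integral_div, hint, ha, mul_div_assoc]
  have hprob : IsProbabilityMeasure
      ((splittingLaw G K x₀ (fun _ => φ) (n + 1)).map (ballRestrict n)) :=
    Measure.isProbabilityMeasure_map (measurable_ballRestrict n).aemeasurable
  -- The marginal is a multiple of the weight on `V_n`. Having total mass one, it must carry the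
  -- factor `Z⁻¹`, so the constants need no computation.
  have h2 : ENNReal.ofReal (Z * a) = 1 := by
    have h3 := hprob.measure_univ
    rw [h1, withDensity_apply _ MeasurableSet.univ, Measure.restrict_univ,
      ← ofReal_integral_eq_lintegral_ofReal
        ((integrable_splittingWeight hKcont hKpos hφ hC n).mul_const a)
        (ae_of_all _ fun σ => mul_nonneg (splittingWeight_pos _ _ _).le ha0.le),
      integral_mul_const] at h3
    exact h3
  rw [ENNReal.ofReal_eq_one] at h2
  have h4 : a = Z⁻¹ := eq_inv_of_mul_eq_one_right h2
  rw [h1, splittingLaw, h4]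
  rfl

end Consistency

/-! ### Extension of the consistent laws to the infinite tree -/

section Existence

open Filter Topology

variable {V : Type*} {G : SimpleGraph V} [G.LocallyFinite] {x₀ : V}

theorem map_domRestrict_of_le {μ ν : Measure (Config V)} {n j : ℕ} (hnj : n ≤ j)
    (h : μ.map (Set.domRestrict (ball G x₀ j)) = ν.map (Set.domRestrict (ball G x₀ j))) :
    μ.map (Set.domRestrict (ball G x₀ n)) = ν.map (Set.domRestrict (ball G x₀ n)) := by
  induction j, hnj using Nat.le_induction with
  | base => exact h
  | succ j _ ih => exact ih (by rw [map_domRestrict_eq, h, ← map_domRestrict_eq])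

/-- Kolmogorov extension along the balls of a tree, for spins in the compact space `[0,1]`. -/
theorem exists_measure_map_domRestrict [Countable V]
    (L : ∀ n, Measure (ball G x₀ n → unitInterval)) [∀ n, IsProbabilityMeasure (L n)]
    (hL : ∀ n, 1 ≤ n → (L (n + 1)).map (ballRestrict n) = L n) :
    ∃ μ : Measure (Config V), IsProbabilityMeasure μ ∧
      ∀ n, 1 ≤ n → μ.map (Set.domRestrict (ball G x₀ n)) = L n := by
  let A : ℕ → ProbabilityMeasure (Config V) := fun n =>
    ⟨(L n).map extend, Measure.isProbabilityMeasure_map measurable_extend.aemeasurable⟩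
  have hAdiag : ∀ n, (A n : Measure (Config V)).map (Set.domRestrict (ball G x₀ n)) = L n := by
    intro n
    change ((L n).map extend).map _ = _
    rw [Measure.map_map (Set.measurable_restrict _) measurable_extend]
    have : Set.domRestrict (ball G x₀ n) ∘ extend = id := funext domRestrict_extend
    rw [this, Measure.map_id]
  have hA : ∀ n, 1 ≤ n → ∀ j, n ≤ j →
      (A j : Measure (Config V)).map (Set.domRestrict (ball G x₀ n)) = L n := by
    intro n hn j hj
    induction j, hj using Nat.le_induction with
    | base => exact hAdiag n
    | succ j hnj ih =>
      rw [← ih]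
      refine map_domRestrict_of_le hnj ?_
      rw [hAdiag j, map_domRestrict_eq, hAdiag (j + 1), hL j (hn.trans hnj)]
  -- Compactness yields a limit of the extended laws along a free ultrafilter. Restriction to `V_n`
  -- is continuous and the restricted laws equal `L n` from index `n` on, so the limit has the
  -- prescribed marginals.
  obtain ⟨μ, -, hμ⟩ := (isCompact_univ (X := ProbabilityMeasure (Config V))).ultrafilter_le_nhds
    ((hyperfilter ℕ).map A) (by simp)
  have hlim : Tendsto A (hyperfilter ℕ) (𝓝 μ) := hμ
  refine ⟨μ, inferInstance, fun n hn => ?_⟩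
  have hcont : Continuous (Set.domRestrict (π := fun _ : V => unitInterval) (ball G x₀ n)) :=
    continuous_pi fun x => continuous_apply (x : V)
  have h1 := ProbabilityMeasure.tendsto_map_of_tendsto_of_continuous A μ hlim hcont
  have h2 : Tendsto (fun j => (A j).map hcont.measurable.aemeasurable) (hyperfilter ℕ)
      (𝓝 (⟨L n, inferInstance⟩ : ProbabilityMeasure (ball G x₀ n → unitInterval))) := by
    refine tendsto_const_nhds.congr' ?_
    have h3 : ∀ᶠ j in (hyperfilter ℕ : Filter ℕ), n ≤ j :=
      Nat.hyperfilter_le_atTop (eventually_ge_atTop n)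
    filter_upwards [h3] with j hj
    exact Subtype.ext (hA n hn j hj).symm
  have h3 := tendsto_nhds_unique h1 h2
  exact congrArg (fun ρ : ProbabilityMeasure (ball G x₀ n → unitInterval) => 
    (ρ : Measure (ball G x₀ n → unitInterval))) h3

/-- Existence of a splitting Gibbs measure with translation-invariant boundary function. -/
theorem exists_isHomogeneousSplitting {K : unitInterval → unitInterval → ℝ}
    (hKcont : Continuous (fun p : unitInterval × unitInterval => K p.1 p.2)) {m M : ℝ}
    (hm0 : 0 < m) (hm : ∀ t u, m ≤ K t u) (hM : ∀ t u, K t u ≤ M) {k : ℕ}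
    (hk : k * (1 - (m / M) ^ 2) < 1) (hG : G.IsTree) (hdeg : G.IsRegularOfDegree (k + 1)) :
    ∃ μ : Measure (Config V), IsProbabilityMeasure μ ∧ IsHomogeneousSplitting G K x₀ μ := by
  obtain ⟨φ, hφ, ⟨C, hC⟩, hfix⟩ := exists_boundaryStep_fixedPoint hKcont hm0 hm hM hk
  have hKpos : ∀ t u, 0 < K t u := fun t u => hm0.trans_le (hm t u)
  have := countable_of_locallyFinite hG.connected x₀
  have := isProbabilityMeasure_splittingLaw (G := G) (x₀ := x₀) hKcont hKpos hφ hC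
  obtain ⟨μ, hμ, hμL⟩ := exists_measure_map_domRestrict (splittingLaw G K x₀ fun _ => φ)
    fun n hn => map_splittingLaw_eq hKcont hm0 hm hφ hC hG hdeg hfix hn
  exact ⟨μ, hμ, fun _ => φ, ⟨fun _ _ => ⟨hφ, C + 1, fun t => (hC t).trans_lt (lt_add_one C)⟩, hμL⟩,
    fun _ _ _ _ _ => rfl⟩

end Existence

/-! ### Invariance for symmetric interactions -/

section Symmetric

open Function Classical

variable {V : Type*} {G : SimpleGraph V} [G.LocallyFinite] {K : unitInterval → unitInterval → ℝ}
  {x₀ : V}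

/-- The root enters only through the orientation of edges, which a symmetric `K` ignores; what
remains is a sum over neighbours, and `g` permutes it. -/
theorem siteLogWeight_comp (hK : ∀ t u, K t u = K u t) (g : G ≃g G) (i : V) (ω : Config V) :
    siteLogWeight G K x₀ (g i) ω = siteLogWeight G K x₀ i fun x => ω (g x) := by
  funext t
  simp only [siteLogWeight, hK _ t, ite_self]
  refine (Finset.sum_equiv g.toEquiv (fun j => ?_) fun j _ => rfl).symm
  simp only [SimpleGraph.mem_neighborFinset]
  exact (g.map_adj_iff).symm

/-- The single-site formulation matters here: an automorphism may move the root and hence the balls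
in the DLR equations, but it carries sites to sites. -/
theorem IsSingleSiteGibbs.map_automorphism
    (hKcont : Continuous (fun p : unitInterval × unitInterval => K p.1 p.2))
    (hK : ∀ t u, K t u = K u t) (g : G ≃g G) {μ : Measure (Config V)}
    (hμ : IsSingleSiteGibbs volume (siteDensity G K x₀) μ) :
    IsSingleSiteGibbs volume (siteDensity G K x₀)
      (μ.map fun (σ : Config V) (x : V) => σ (g x)) := by
  rintro i f hf ⟨Λ, hΛ⟩
  have hgm : Measurable fun (σ : Config V) (x : V) => σ (g x) :=
    measurable_pi_lambda _ fun x => measurable_pi_apply (g x)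
  have hm : Measurable fun x : Config V × unitInterval =>
      ENNReal.ofReal (siteDensity G K x₀ i x.1 x.2) * f (update x.1 i x.2) :=
    (measurable_siteDensity hKcont i).ennreal_ofReal.mul (hf.comp (measurable_update_uncurry i))
  have hm' : Measurable fun ω : Config V =>
      ∫⁻ t, ENNReal.ofReal (siteDensity G K x₀ i ω t) * f (update ω i t) := hm.lintegral_prod_right'
  rw [lintegral_map hf hgm, lintegral_map hm' hgm]
  rw [hμ (g i) (fun σ => f fun x => σ (g x)) (hf.comp hgm) ⟨Λ.image g, fun ω ω' h => hΛ fun j hj =>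
    h (g j) (Finset.mem_coe.2 (Finset.mem_image_of_mem g hj))⟩]
  refine lintegral_congr fun ω => lintegral_congr fun t => ?_
  have h1 : (fun x => update ω (g i) t (g x)) = update (fun x => ω (g x)) i t := by
    funext x
    by_cases hx : x = i
    · subst hx; simp
    · rw [update_of_ne hx, update_of_ne (fun h => hx (g.injective h))]
  rw [h1]
  simp only [siteDensity, siteLogWeight_comp hK]

end Symmetric

/-! ### The numerical condition and the main theorem -/

/-- With `r = M / m` the claim amounts to `k * (r ^ 2 - 1) < 1`, that is `a * (r + 1) < 1` for `a =
k * (r - 1)`. Bernoulli gives `1 + a ≤ r ^ k`, and since `x - 1 / x` increases, the hypothesis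
passes to `1 + a`. -/
theorem mul_one_sub_sq_lt_one {k : ℕ} (hk : 2 ≤ k) {m M : ℝ} (hm0 : 0 < m) (hmM : m ≤ M)
    (hI : (M / m) ^ k - (m / M) ^ k < 1 / (k : ℝ)) : ((k + 1 : ℕ) : ℝ) * (1 - (m / M) ^ 2) < 1 := by
  have hM0 : 0 < M := hm0.trans_le hmM
  have hk2 : (2 : ℝ) ≤ k := by exact_mod_cast hk
  set r := M / m with hr
  have hr1 : 1 ≤ r := (one_le_div hm0).2 hmM
  have hr0 : 0 < r := by linarith
  have hinv : m / M = r⁻¹ := (inv_div M m).symm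
  rw [hinv] at hI ⊢
  set a : ℝ := k * (r - 1) with ha
  have ha0 : 0 ≤ a := mul_nonneg (by linarith) (by linarith)
  set P := r ^ k with hP
  have hPa : 1 + a ≤ P := by
    have := one_add_mul_le_pow (a := r - 1) (by linarith) k
    rwa [add_sub_cancel] at this
  have hP0 : 0 < P := by linarith
  rw [inv_pow, ← hP] at hI
  have h1 : (1 + a) - (1 + a)⁻¹ < 1 / k := by
    have h2 : P⁻¹ ≤ (1 + a)⁻¹ := inv_anti₀ (by linarith) hPa
    linarith
  have h1' : (1 + a) - (1 + a)⁻¹ < 1 / 2 :=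
    h1.trans_le (one_div_le_one_div_of_le (by norm_num) hk2)
  have h3 : 3 * a + 2 * a ^ 2 < 1 := by
    have h4 : (1 + a) * ((1 + a) - (1 + a)⁻¹) < (1 + a) * (1 / 2) :=
      mul_lt_mul_of_pos_left h1' (by linarith)
    rw [mul_sub, mul_inv_cancel₀ (by linarith : (1 + a) ≠ 0)] at h4
    nlinarith
  -- As `k ≥ 2`, `r + 1 ≤ 2 + a / 2`, and `2 * a + a ^ 2 / 2` is below the quantity in `h3`.
  have h5 : a * (r + 1) < 1 := by
    have h6 : 2 * (r - 1) ≤ a := by rw [ha]; nlinarith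
    nlinarith
  have h7 : (k + 1 : ℝ) * (r ^ 2 - 1) < r ^ 2 := by rw [ha] at h5; nlinarith
  have h8 : ((k + 1 : ℕ) : ℝ) * (1 - r⁻¹ ^ 2) = (k + 1 : ℝ) * (r ^ 2 - 1) / r ^ 2 := by
    push_cast; field_simp
  rw [h8, div_lt_one (by positivity)]
  exact h7

end CayleyGibbs

end

theorem theorem6 {V : Type*} (G : SimpleGraph V) [G.LocallyFinite] (k : ℕ) (hk : 2 ≤ k)
    (hG : G.IsTree) (hdeg : G.IsRegularOfDegree (k + 1)) (x₀ : V)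
    (K : unitInterval → unitInterval → ℝ)
    (hKcont : Continuous (fun p : unitInterval × unitInterval => K p.1 p.2))
    (hKpos : ∀ t u, 0 < K t u)
    (m M : ℝ)
    (hm : IsLeast (Set.range (fun p : unitInterval × unitInterval => K p.1 p.2)) m)
    (hM : IsGreatest (Set.range (fun p : unitInterval × unitInterval => K p.1 p.2)) M)
    (hI : (M / m) ^ k - (m / M) ^ k < 1 / (k : ℝ)) :
    ∃ μ : MeasureTheory.Measure (CayleyGibbs.Config V),
      MeasureTheory.IsProbabilityMeasure μ ∧
      CayleyGibbs.IsGibbs G K x₀ μ ∧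
      CayleyGibbs.IsHomogeneousSplitting G K x₀ μ ∧
      (∀ ν : MeasureTheory.Measure (CayleyGibbs.Config V),
        MeasureTheory.IsProbabilityMeasure ν →
        CayleyGibbs.IsHomogeneousSplitting G K x₀ ν → ν = μ) ∧
      (∀ Γ : Subgroup (G ≃g G), CayleyGibbs.IsVertexTransitive Γ →
        ((∀ t u, K t u = K u t) → CayleyGibbs.IsInvariant Γ μ) ∧
        (∀ ν : MeasureTheory.Measure (CayleyGibbs.Config V),
          MeasureTheory.IsProbabilityMeasure ν →
          CayleyGibbs.IsInvariant Γ ν →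
          (CayleyGibbs.IsGibbs G K x₀ ν ∨ CayleyGibbs.IsSplitting G K x₀ ν) → ν = μ)) := by
  classical
  obtain ⟨⟨p, rfl⟩, hmle⟩ := hm
  have hm0 : 0 < K p.1 p.2 := hKpos _ _
  have hm' : ∀ t u, K p.1 p.2 ≤ K t u := fun t u => hmle ⟨(t, u), rfl⟩
  have hM' : ∀ t u, K t u ≤ M := fun t u => hM.2 ⟨(t, u), rfl⟩
  have hmM : K p.1 p.2 ≤ M := hM' _ _
  have hc := CayleyGibbs.mul_one_sub_sq_lt_one hk hm0 hmM hI
  have hc0 : 0 ≤ 1 - (K p.1 p.2 / M) ^ 2 := by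
    have h1 : 0 ≤ K p.1 p.2 / M := (div_pos hm0 (hm0.trans_le hmM)).le
    have h2 := pow_le_one₀ h1 ((div_le_one (hm0.trans_le hmM)).2 hmM) (n := 2)
    linarith
  have hspec := CayleyGibbs.isSingleSiteSpec_siteDensity (G := G) (x₀ := x₀) hKcont hm0 hm' hM'
  have huniq : ∀ ν₁ ν₂ : MeasureTheory.Measure (CayleyGibbs.Config V),
      MeasureTheory.IsProbabilityMeasure ν₁ → MeasureTheory.IsProbabilityMeasure ν₂ →
      CayleyGibbs.IsSingleSiteGibbs MeasureTheory.volume (CayleyGibbs.siteDensity G K x₀) ν₁ →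
      CayleyGibbs.IsSingleSiteGibbs MeasureTheory.volume (CayleyGibbs.siteDensity G K x₀) ν₂ →
      ν₁ = ν₂ := fun ν₁ ν₂ _ _ h₁ h₂ =>
    hspec.unique hc0 h₁ h₂ (mul_nonneg (Nat.cast_nonneg _) hc0)
      (fun i => le_of_eq (by rw [SimpleGraph.card_neighborFinset_eq_degree, hdeg i])) hc
  have hgibbs : ∀ ν : MeasureTheory.Measure (CayleyGibbs.Config V),
      MeasureTheory.IsProbabilityMeasure ν →
      (CayleyGibbs.IsGibbs G K x₀ ν ∨ CayleyGibbs.IsSplitting G K x₀ ν) →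
      CayleyGibbs.IsSingleSiteGibbs MeasureTheory.volume (CayleyGibbs.siteDensity G K x₀) ν := by
    rintro ν _ (h | h)
    · exact h.isSingleSiteGibbs hKcont hKpos hG
    · exact (h.isGibbs hKcont hKpos).isSingleSiteGibbs hKcont hKpos hG
  -- Existence needs only the `k` successors, so the Dobrushin condition for `k + 1` neighbours is
  -- more than enough.
  have hkc : (k : ℝ) * (1 - (K p.1 p.2 / M) ^ 2) < 1 := by
    push_cast at hc
    nlinarith
  obtain ⟨μ, hμ, hμs⟩ :=
    CayleyGibbs.exists_isHomogeneousSplitting (x₀ := x₀) hKcont hm0 hm' hM' hkc hG hdeg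
  have hsplit : ∀ ν : MeasureTheory.Measure (CayleyGibbs.Config V),
      CayleyGibbs.IsHomogeneousSplitting G K x₀ ν → CayleyGibbs.IsSplitting G K x₀ ν :=
    fun ν ⟨h, hh, _⟩ => ⟨h, hh⟩
  have hμg := hgibbs μ hμ (Or.inr (hsplit μ hμs))
  refine ⟨μ, hμ, (hsplit μ hμs).isGibbs hKcont hKpos, hμs, fun ν hν h =>
    huniq ν μ hν hμ (hgibbs ν hν (Or.inr (hsplit ν h))) hμg, fun Γ _ => ⟨fun hK g _ => ?_,
    fun ν hν _ h => huniq ν μ hν hμ (hgibbs ν hν h) hμg⟩⟩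
  have hmeas : Measurable fun (σ : CayleyGibbs.Config V) (x : V) => σ (g x) :=
    measurable_pi_lambda _ fun x => measurable_pi_apply (g x)
  exact huniq _ μ (MeasureTheory.Measure.isProbabilityMeasure_map hmeas.aemeasurable) hμ
    (hμg.map_automorphism hKcont hK g) hμg
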